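/- Let $\mathbb F\in\{\mathbb R,\mathbb C\}$ and $\Sigma=\{0,1\}$. A partial function $F:\subseteq\Sigma^\omega\to\Sigma^\omega$ is computable if a machine with one-way output tape transforms every $p\in\operatorname{dom}F$ into $F(p)$; a map $f:X\to Y$ between represented spaces $(X,\delta),(Y,\delta')$ is computable if some computable $F$ sends every $\delta$-name of a point $x$ to a $\delta'$-name of $f(x)$. Here $n\in\mathbb N$ has the name $1^n0^\omega$, pairs are named by pairs of names, and a point $x$ of the disjoint union of represented spaces $X_i$ ($i\in\mathbb N$) is named by $i$ together with a name of $x$ in $X_i$. A metric space with a dense sequence $\alpha$ has its Cauchy representation: $01^{n_0+1}01^{n_1+1}\dots$ is a name of $x$ if $d(\alpha(n_i),\alpha(n_j))<2^{-i}$ for all $j>i$ and $\alpha(n_i)\to x$; $\mathbb R$ is represented in this way via a standard numbering of $\mathbb Q$. A computable Hilbert space is a Hilbert space $H$ over $\mathbb F$ with a sequence in $H$ whose linear span is dense, such that the distances $d(\alpha(m),\alpha(n))$ form a computable double sequence of reals, where $\alpha$ is the standard numbering of the finite rational (for $\mathbb F=\mathbb C$: complex rational) linear combinations of the sequence; $H$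 carries the Cauchy representation given by $\alpha$. A sequence $(H_i)_{i\in\mathbb N}$ of computable Hilbert spaces is understood uniformly: with $\alpha_i$ the numbering for $H_i$, the map $(i,m,n)\mapsto d(\alpha_i(m),\alpha_i(n))$ is computable. Theorem. Let $H$ be a computable Hilbert space, let $(H_i)_{i\in\mathbb N}$ be a sequence of computable Hilbert spaces, and for each $i$ let $(e_{ik})_{k\in\mathbb N}$ be an orthonormal basis of $H_i$ (zero vectors may be inserted in the sequence, so that finite-dimensional $H_i$ are allowed) such that $(i,k)\mapsto e_{ik}\in H_i$ is computable. Let $(\Lambda_i)_{i\in\mathbb N}$ be a computable g-frame for $H$ with respect to $(H_i)$, that is, $\Lambda_i:H\to H_i$ are bounded linear operators, the map $(i,f)\mapsto\Lambda_if\in H_i$ is computable, and there are constants $0<A\le B<\infty$ with $$A\|f\|^2\le\sum_{i\in\mathbb N}\|\Lambda_if\|^2\le B\|f\|^2\qquad(f\in H).$$ Suppose that $(\|\Lambda_i^*e_{ik}\|)_{i,k}$ is a computable double sequence of real numbers. Then the synthesis operator $$T:\Bigl(\sum_{i\in\mathbb N}\oplus H_i\Bigr)_{l^2}\to H,\qquad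 T((f_i)_i)=\sum_{i\in\mathbb N}\Lambda_i^*f_i,$$ is a well-defined bounded linear operator (the series converges unconditionally) and it is computable, where $(\sum_{i}\oplus H_i)_{l^2}$ carries the Cauchy representation given by the rational linear combinations of the vectors $E_{ik}$ with $i$-th component $e_{ik}$ and all other components $0$. -/

import Mathlib

/-! Type-2 computability on represented spaces, computable Hilbert spaces, computable g-frames. -/

namespace CompAnalysis

noncomputable section

/-! ### Type-2 computability on `Σ^ω`, with `Σ = {0, 1}` (`false` is `0` and `true` is `1`) -/

/-- The space `Σ^ω` of infinite binary sequences. -/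
abbrev Name := ℕ → Bool

/-- The prefix of length `n` of an infinite sequence. -/
def pre (p : Name) (n : ℕ) : List Bool := (List.range n).map p

/-- A partial function `F :⊆ Σ^ω → Σ^ω` is computable if some machine with a one-way output tape
transforms every `p ∈ dom F` into `F p`. Here `φ w` is the (finite) output that the machine has
written after having read the finite input word `w`: `φ` is a computable function on words,
a longer input can only prolong the output, and on the input `p` the outputs `φ (pre p m)`
exhaust the infinite sequence `F p`. -/
def TypeTwoComputable (F : Name →. Name) : Prop :=
  ∃ φ : List Bool → List Bool, Computable φ ∧ (∀ u v, u <+: v → φ u <+: φ v) ∧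
    ∀ p, ∀ q ∈ F p, ∀ n, ∃ m, pre q n <+: φ (pre p m)

/-- A representation of `X`: a surjective partial function `Σ^ω ⇀ X`, given by its graph
(`names p x` says that `p` is a name of `x`). -/
structure Representation (X : Type*) where
  names : Name → X → Prop
  functional : ∀ p x y, names p x → names p y → x = y
  surjective : ∀ x, ∃ p, names p x

/-- `f` is `(δ, δ')`-computable: some computable `F :⊆ Σ^ω → Σ^ω` sends every `δ`-name of a
point `x` to a `δ'`-name of `f x`. -/
def IsComputableMap {X Y : Type*} (δ : Representation X) (δ' : Representation Y) (f : X → Y) :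
    Prop :=
  ∃ F : Name →. Name, TypeTwoComputable F ∧
    ∀ p x, δ.names p x → ∃ q ∈ F p, δ'.names q (f x)

/-! ### Basic representations -/

/-- The name `1^n 0^ω` of a natural number `n`. -/
def natName (n : ℕ) : Name := fun k => decide (k < n)

theorem natName_injective : Function.Injective natName := by
  intro m n h
  have hk : ∀ k, k < m ↔ k < n := fun k => by
    simpa [natName] using congrFun h k
  rcases lt_trichotomy m n with hlt | heq | hgt
  · exact absurd ((hk m).2 hlt) (lt_irrefl _)
  · exact heq
  · exact absurd ((hk n).1 hgt) (lt_irrefl _)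

/-- The representation of `ℕ` by `δ(1^n 0^ω) = n`. -/
def natRep : Representation ℕ where
  names p n := p = natName n
  functional _ _ _ h h' := natName_injective (h.symm.trans h')
  surjective n := ⟨natName n, rfl⟩

/-- First component of the sequence `⟨p, q⟩ = p₀ q₀ p₁ q₁ …`. -/
def evens (r : Name) : Name := fun k => r (2 * k)

/-- Second component of the sequence `⟨p, q⟩ = p₀ q₀ p₁ q₁ …`. -/
def odds (r : Name) : Name := fun k => r (2 * k + 1)

/-- The sequence `⟨p, q⟩ = p₀ q₀ p₁ q₁ …`. -/
def interleave (p q : Name) : Name := fun k => if k % 2 = 0 then p (k / 2) else q (k / 2)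

theorem evens_interleave (p q : Name) : evens (interleave p q) = p := by
  funext k
  simp [evens, interleave]

theorem odds_interleave (p q : Name) : odds (interleave p q) = q := by
  funext k
  have h1 : (2 * k + 1) % 2 = 1 := by omega
  have h2 : (2 * k + 1) / 2 = k := by omega
  simp [odds, interleave, h1, h2]

/-- The product representation: `⟨p, q⟩` is a name of `(x, y)` if `p` is a name of `x` and `q`
is a name of `y`. -/
def prodRep {X Y : Type*} (δ : Representation X) (δ' : Representation Y) :
    Representation (X × Y) where
  names r z := δ.names (evens r) z.1 ∧ δ'.names (odds r) z.2
  functional _ _ _ h h' :=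
    Prod.ext (δ.functional _ _ _ h.1 h'.1) (δ'.functional _ _ _ h.2 h'.2)
  surjective := by
    rintro ⟨x, y⟩
    obtain ⟨p, hp⟩ := δ.surjective x
    obtain ⟨q, hq⟩ := δ'.surjective y
    refine ⟨interleave p q, ?_, ?_⟩
    · simpa [evens_interleave] using hp
    · simpa [odds_interleave] using hq

/-- The representation of the disjoint union of a sequence of represented spaces: `⟨p, q⟩` is a
name of `x ∈ X i` if `p` is a name of the number `i` and `q` is a name of `x`. -/
def sigmaRep {X : ℕ → Type*} (δ : ∀ i, Representation (X i)) : Representation (Σ i, X i) where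
  names r z := natRep.names (evens r) z.1 ∧ (δ z.1).names (odds r) z.2
  functional := by
    rintro r ⟨i, x⟩ ⟨j, y⟩ ⟨h1, h2⟩ ⟨h3, h4⟩
    obtain rfl : i = j := natRep.functional _ _ _ h1 h3
    obtain rfl : x = y := (δ i).functional _ _ _ h2 h4
    rfl
  surjective := by
    rintro ⟨i, x⟩
    obtain ⟨p, hp⟩ := (δ i).surjective x
    refine ⟨interleave (natName i) p, ?_, ?_⟩
    · simp [evens_interleave, natRep]
    · simpa [odds_interleave] using hp

/-! ### The Cauchy representation -/

/-- The position of the `i`-th `0` in the sequence `0 1^(n₀+1) 0 1^(n₁+1) 0 1^(n₂+1) …`. -/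
def zeroPos (n : ℕ → ℕ) (i : ℕ) : ℕ := ∑ l ∈ Finset.range i, (n l + 2)

open Classical in
/-- The sequence `0 1^(n₀+1) 0 1^(n₁+1) 0 1^(n₂+1) …`. -/
def seqName (n : ℕ → ℕ) : Name := fun k => decide (k ∉ Set.range (zeroPos n))

theorem zeroPos_succ (n : ℕ → ℕ) (i : ℕ) : zeroPos n (i + 1) = zeroPos n i + (n i + 2) := by
  simp [zeroPos, Finset.sum_range_succ]

theorem zeroPos_strictMono (n : ℕ → ℕ) : StrictMono (zeroPos n) :=
  strictMono_nat_of_lt_succ fun i => by rw [zeroPos_succ]; omega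

theorem seqName_injective : Function.Injective seqName := by
  intro m n h
  have hr : Set.range (zeroPos m) = Set.range (zeroPos n) := by
    ext k
    have := congrFun h k
    simp only [seqName, decide_eq_decide] at this
    exact not_iff_not.1 this
  have hz := ((zeroPos_strictMono m).range_inj (zeroPos_strictMono n)).1 hr
  funext i
  have h1 := congrFun hz i
  have h2 := congrFun hz (i + 1)
  rw [zeroPos_succ, zeroPos_succ] at h2
  omega

/-- The Cauchy representation of a metric space with respect to a dense sequence `α`:
`0 1^(n₀+1) 0 1^(n₁+1) …` is a name of `lim α (n i)` if `α (n i)` converges and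
`d (α (n i), α (n j)) < 2⁻ⁱ` for all `j > i`. -/
def cauchyRep {X : Type*} [MetricSpace X] (α : ℕ → X) (hα : DenseRange α) :
    Representation X where
  names p x := ∃ n : ℕ → ℕ, p = seqName n ∧
    (∀ i j, i < j → dist (α (n i)) (α (n j)) < (1 / 2 : ℝ) ^ i) ∧
    Filter.Tendsto (fun i => α (n i)) Filter.atTop (nhds x)
  functional := by
    rintro p x y ⟨n, hn, -, hx⟩ ⟨m, hm, -, hy⟩
    obtain rfl : n = m := seqName_injective (hn.symm.trans hm)
    exact tendsto_nhds_unique hx hy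
  surjective := by
    intro x
    have hex : ∀ i : ℕ, ∃ k, dist x (α k) < (1 / 2 : ℝ) ^ (i + 1) := fun i =>
      hα.exists_dist_lt x (by positivity)
    choose n hn using hex
    refine ⟨seqName n, n, rfl, ?_, ?_⟩
    · intro i j hij
      have h1 := hn i
      have h2 := hn j
      have h3 : (1 / 2 : ℝ) ^ (j + 1) ≤ (1 / 2 : ℝ) ^ (i + 1) :=
        pow_le_pow_of_le_one (by norm_num) (by norm_num) (by omega)
      have h4 : (1 / 2 : ℝ) ^ (i + 1) = (1 / 2 : ℝ) ^ i / 2 := by rw [pow_succ]; ring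
      have h5 := dist_triangle_left (α (n i)) (α (n j)) x
      linarith
    · rw [tendsto_iff_dist_tendsto_zero]
      have h0 : Filter.Tendsto (fun i : ℕ => (1 / 2 : ℝ) ^ (i + 1)) Filter.atTop (nhds 0) :=
        (tendsto_pow_atTop_nhds_zero_of_lt_one (by norm_num) (by norm_num)).comp
          (Filter.tendsto_add_atTop_nat 1)
      refine squeeze_zero (fun _ => dist_nonneg) (fun i => ?_) h0
      rw [dist_comm]
      exact (hn i).le

/-! ### The real numbers and the scalar field -/

/-- The numbering `⟨⟨i, j⟩, k⟩ ↦ (i - j) / (k + 1)` of the rational numbers, with Mathlib's pairing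
function `Nat.pair` on `ℕ`. -/
def realNum (n : ℕ) : ℝ :=
  (((Nat.unpair (Nat.unpair n).1).1 : ℝ) - ((Nat.unpair (Nat.unpair n).1).2 : ℝ)) /
    (((Nat.unpair n).2 : ℝ) + 1)

theorem realNum_denseRange : DenseRange realNum := by
  have hsub : Set.range ((↑) : ℚ → ℝ) ⊆ Set.range realNum := by
    rintro _ ⟨q, rfl⟩
    refine ⟨Nat.pair (Nat.pair q.num.toNat (-q.num).toNat) (q.den - 1), ?_⟩
    have h1 : ((q.num.toNat : ℝ) - ((-q.num).toNat : ℝ)) = (q.num : ℝ) := by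
      exact_mod_cast Int.toNat_sub_toNat_neg q.num
    have h2 : (((q.den - 1 : ℕ) : ℝ) + 1) = (q.den : ℝ) := by
      have : q.den - 1 + 1 = q.den := Nat.succ_pred_eq_of_pos q.den_pos
      exact_mod_cast this
    simp only [realNum, Nat.unpair_pair, h1, h2]
    exact (Rat.cast_def q).symm
  exact Rat.denseRange_cast.mono hsub

/-- The Cauchy representation of the real numbers. -/
def realRep : Representation ℝ := cauchyRep realNum realNum_denseRange

section Hilbert

variable (𝕜 : Type*) [RCLike 𝕜]

/-- The numbering `⟨m, n⟩ ↦ realNum m + realNum n * i` of the (complex) rational elements of the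
scalar field `𝕜`, which is `ℝ` or `ℂ`; for `𝕜 = ℝ` one has `RCLike.I = 0`. -/
def scalarNum (n : ℕ) : 𝕜 :=
  (realNum (Nat.unpair n).1 : 𝕜) + (realNum (Nat.unpair n).2 : 𝕜) * RCLike.I

theorem scalarNum_denseRange : DenseRange (scalarNum 𝕜) := by
  have hg : Function.Surjective (fun z : ℝ × ℝ => (z.1 : 𝕜) + (z.2 : 𝕜) * RCLike.I) :=
    fun w => ⟨(RCLike.re w, RCLike.im w), RCLike.re_add_im w⟩
  have hc : Continuous (fun z : ℝ × ℝ => (z.1 : 𝕜) + (z.2 : 𝕜) * RCLike.I) := by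
    have := RCLike.continuous_ofReal (K := 𝕜)
    fun_prop
  have hp : DenseRange (Prod.map realNum realNum) :=
    realNum_denseRange.prodMap realNum_denseRange
  have h := hg.denseRange.comp hp hc
  refine h.mono ?_
  rintro _ ⟨⟨a, b⟩, rfl⟩
  exact ⟨Nat.pair a b, by simp [scalarNum]⟩

variable {H : Type*} [NormedAddCommGroup H] [InnerProductSpace 𝕜 H]

/-- The numbering of the rational linear combinations of a sequence `b`: the number `n` codes the
finite list `(n₀, …, n_{k-1})`, and it is sent to `∑ scalarNum(nᵢ) bᵢ`. -/
def ratComb (b : ℕ → H) (n : ℕ) : H :=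
  ∑ k : Fin (Denumerable.ofNat (List ℕ) n).length,
    scalarNum 𝕜 ((Denumerable.ofNat (List ℕ) n).get k) • b k

/-- `b` is a fundamental sequence: its linear span is dense. -/
def IsFundamental (b : ℕ → H) : Prop :=
  Dense (Submodule.span 𝕜 (Set.range b) : Set H)

variable {𝕜}

theorem ratComb_denseRange {b : ℕ → H} (hb : IsFundamental 𝕜 b) : DenseRange (ratComb 𝕜 b) := by
  have key : (Submodule.span 𝕜 (Set.range b) : Set H) ⊆ closure (Set.range (ratComb 𝕜 b)) := by
    intro x hx
    obtain ⟨c, rfl⟩ := Finsupp.mem_span_range_iff_exists_finsupp.1 hx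
    obtain ⟨N, hN⟩ := c.support.exists_nat_subset_range
    have hsum : (c.sum fun i a => a • b i) = ∑ k : Fin N, c k • b k := by
      rw [Finsupp.sum_of_support_subset _ hN _ (by simp), Finset.sum_range]
    rw [hsum]
    have hd : DenseRange (Pi.map fun _ : Fin N => scalarNum 𝕜) :=
      DenseRange.piMap fun _ => scalarNum_denseRange 𝕜
    have hcont : Continuous fun a : Fin N → 𝕜 => ∑ k : Fin N, a k • b k := by fun_prop
    have hmem := hcont.range_subset_closure_image_dense hd
      (Set.mem_range_self (fun k : Fin N => c k))
    refine closure_mono ?_ hmem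
    rintro _ ⟨_, ⟨m, rfl⟩, rfl⟩
    refine ⟨Encodable.encode (List.ofFn m), ?_⟩
    have hl : ∀ l : List ℕ, l = List.ofFn m →
        ∑ k : Fin l.length, scalarNum 𝕜 (l.get k) • b k =
          ∑ k : Fin N, scalarNum 𝕜 (m k) • b k := by
      rintro l rfl
      refine Fintype.sum_equiv (finCongr (by simp)) _ _ ?_
      intro k
      simp only [List.get_ofFn, finCongr_apply, Fin.val_cast]
    exact hl _ (Denumerable.ofNat_encode _)
  intro x
  exact closure_minimal key isClosed_closure (hb x)

/-- The Cauchy representation of a Hilbert space with respect to a fundamental sequence. -/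
def hilbertRep {b : ℕ → H} (hb : IsFundamental 𝕜 b) : Representation H :=
  cauchyRep (ratComb 𝕜 b) (ratComb_denseRange hb)

variable (𝕜)

/-- `(H, b)` is a computable Hilbert space: `b` is a fundamental sequence, and the distances of
the rational linear combinations of `b` form a computable double sequence of real numbers.
(Completeness of `H` is the type class `CompleteSpace H`.) -/
structure IsComputableHilbertSpace (b : ℕ → H) : Prop where
  fundamental : IsFundamental 𝕜 b
  dist_computable : IsComputableMap (prodRep natRep natRep) realRep
    fun t : ℕ × ℕ => dist (ratComb 𝕜 b t.1) (ratComb 𝕜 b t.2)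

variable {G : ℕ → Type*} [∀ i, NormedAddCommGroup (G i)] [∀ i, InnerProductSpace 𝕜 (G i)]

/-- `(G i, c i)` is a (uniform) sequence of computable Hilbert spaces: the distances of rational
linear combinations are computable uniformly in the index `i` of the space. -/
structure IsComputableHilbertSequence (c : ∀ i, ℕ → G i) : Prop where
  fundamental : ∀ i, IsFundamental 𝕜 (c i)
  dist_computable : IsComputableMap (prodRep natRep (prodRep natRep natRep)) realRep
    fun t : ℕ × (ℕ × ℕ) => dist (ratComb 𝕜 (c t.1) t.2.1) (ratComb 𝕜 (c t.1) t.2.2)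

variable {𝕜}

/-- The representation of the disjoint union of the spaces `G i`, each with its Cauchy
representation. -/
def unionRep {c : ∀ i, ℕ → G i} (hc : IsComputableHilbertSequence 𝕜 c) :
    Representation (Σ i, G i) :=
  sigmaRep fun i => hilbertRep (hc.fundamental i)

variable (𝕜)

/-- The nonzero members of the sequence `e` form an orthonormal basis of `H`. For an
infinite-dimensional space the sequence may be an orthonormal basis indexed by `ℕ`; an orthonormal
basis of a finite-dimensional space is completed by zero vectors. -/
structure IsOrthonormalBasisSeq (e : ℕ → H) : Prop where
  orthonormal : Orthonormal 𝕜 fun k : {k : ℕ // e k ≠ 0} => e k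
  fundamental : IsFundamental 𝕜 e

variable {𝕜}

/-- `e i` is an orthonormal basis of `G i` for every `i`, and `e i k` can be computed from `i` and
`k`. -/
structure IsComputableOrthonormalBases {c : ∀ i, ℕ → G i}
    (hc : IsComputableHilbertSequence 𝕜 c) (e : ∀ i, ℕ → G i) : Prop where
  basis : ∀ i, IsOrthonormalBasisSeq 𝕜 (e i)
  computable : IsComputableMap (prodRep natRep natRep) (unionRep hc)
    fun t : ℕ × ℕ => (⟨t.1, e t.1 t.2⟩ : Σ i, G i)

/-- `Λ` is a g-frame for `H` with respect to the spaces `G i`. -/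
def IsGFrame (Λ : ∀ i, H →L[𝕜] G i) : Prop :=
  ∃ A B : ℝ, 0 < A ∧ A ≤ B ∧ ∀ f : H, Summable (fun i => ‖Λ i f‖ ^ 2) ∧
    A * ‖f‖ ^ 2 ≤ ∑' i, ‖Λ i f‖ ^ 2 ∧ ∑' i, ‖Λ i f‖ ^ 2 ≤ B * ‖f‖ ^ 2

/-- `Λ` is a computable g-frame: a g-frame for which `Λ i f` can be computed from the number `i`
and a name of `f`. -/
structure IsComputableGFrame {b : ℕ → H} (hb : IsComputableHilbertSpace 𝕜 b)
    {c : ∀ i, ℕ → G i} (hc : IsComputableHilbertSequence 𝕜 c) (Λ : ∀ i, H →L[𝕜] G i) :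
    Prop where
  gframe : IsGFrame Λ
  computable : IsComputableMap (prodRep natRep (hilbertRep hb.fundamental)) (unionRep hc)
    fun t : ℕ × H => (⟨t.1, Λ t.1 t.2⟩ : Σ i, G i)

/-! ### The `ℓ²`-sum -/

/-- The double sequence `E i k` in the `ℓ²`-sum of the spaces `G i` (the vector `e i k` at the place
`i`, zero elsewhere), as a sequence: the number `⟨i, k⟩` is sent to `E i k`. -/
def sumSeq (e : ∀ i, ℕ → G i) (n : ℕ) : lp G 2 :=
  lp.single 2 (Nat.unpair n).1 (e (Nat.unpair n).1 (Nat.unpair n).2)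

theorem sumSeq_fundamental {e : ∀ i, ℕ → G i} (he : ∀ i, IsFundamental 𝕜 (e i)) :
    IsFundamental 𝕜 (sumSeq e) := by
  set S : Submodule 𝕜 (lp G 2) := (Submodule.span 𝕜 (Set.range (sumSeq e))).topologicalClosure
    with hS
  have hclosed : IsClosed (S : Set (lp G 2)) := Submodule.isClosed_topologicalClosure _
  have hsingle : ∀ i (x : G i), lp.single 2 i x ∈ S := by
    intro i x
    let s : G i →L[𝕜] lp G 2 := lp.singleContinuousLinearMap 𝕜 G 2 i
    have hpre : IsClosed ((S.comap s.toLinearMap : Submodule 𝕜 (G i)) : Set (G i)) :=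
      hclosed.preimage s.continuous
    have hspan : Submodule.span 𝕜 (Set.range (e i)) ≤ S.comap s.toLinearMap := by
      rw [Submodule.span_le]
      rintro _ ⟨k, rfl⟩
      refine Submodule.le_topologicalClosure _ (Submodule.subset_span ⟨Nat.pair i k, ?_⟩)
      have hq : ∀ q : ℕ × ℕ, q = (i, k) → lp.single 2 q.1 (e q.1 q.2) = s (e i k) := by
        rintro _ rfl
        rfl
      exact hq _ (Nat.unpair_pair i k)
    exact closure_minimal (show (_ : Set (G i)) ⊆ _ from hspan) hpre (he i x)
  intro f
  have hf := lp.hasSum_single (p := 2) (by norm_num) f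
  exact hclosed.mem_of_tendsto hf
    (Filter.Eventually.of_forall fun t => S.sum_mem fun i _ => hsingle i (f i))

/-- The Cauchy representation of the `ℓ²`-sum of the spaces `G i` with respect to the fundamental
sequence formed by the vectors `E i k`. -/
def sumRep {c : ∀ i, ℕ → G i} {hc : IsComputableHilbertSequence 𝕜 c} {e : ∀ i, ℕ → G i}
    (he : IsComputableOrthonormalBases hc e) : Representation (lp G 2) :=
  hilbertRep (sumSeq_fundamental (𝕜 := 𝕜) fun i => (he.basis i).fundamental)

end Hilbert

end

end CompAnalysis

/-!
The analysis operator `Θ f = (Λᵢ f)ᵢ` is bounded by the upper frame bound, and the synthesis operator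
is its adjoint: `Θ*` sends the vector `x` at the place `i` to `Λᵢ* x`, so the expansion of
`f ∈ ℓ²` into its components is mapped to the (unconditionally convergent) series `∑ Λᵢ* fᵢ`
(`IsGFrame.exists_synthesis`).

A bounded linear operator `T` is computable as soon as its values at the fundamental sequence can be
computed (`isComputableMap_of_approx`): from a name of `x` one reads rational combinations that
converge rapidly to `x`, computes their images to a suitable precision, and absorbs a bound of `‖T‖`
into a finite shift of the index. For the synthesis operator this reduces the claim to the
computability of the vectors `Λᵢ* eᵢₖ = T Eᵢₖ`.

The adjoints cannot be evaluated directly, but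
`‖x - Λ* y‖² = ‖x‖² + ‖Λ x - y‖² - ‖Λ x‖² - ‖y‖² + ‖Λ* y‖²`
expresses the distance of `x` from `Λ* y` without any inner product. For `y = eᵢₖ` and a rational
combination `x` each term on the right is computable, the last one by hypothesis. Hence one can search
for an `x` that is as close to `Λᵢ* eᵢₖ` as desired (`exists_approx_adjoint`); the search succeeds by
density.

These computations are carried out with recursive functions on natural numbers. The passage from
machines on infinite sequences to such functions is `TypeTwoComputable.computable_of_seqName`: on
primitive recursive inputs the output of a machine can be decoded run by run. The passage back is
`exists_typeTwoComputable_seqName`.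
-/

namespace CompAnalysis

/-! ### Words and names of integer sequences -/

/-- One step of the scanner that reads a binary word: the state consists of the length of the
current run of `1`s and of the list of the lengths of the runs that a `0` has closed. -/
def scanStep (s : ℕ × List ℕ) (x : Bool) : ℕ × List ℕ :=
  bif x then (s.1 + 1, s.2) else (0, s.2 ++ [s.1])

/-- The lengths of the (possibly empty) runs of `1`s in a word that are followed by a `0`. -/
def runs (u : List Bool) : List ℕ := (u.foldl scanStep (0, [])).2

theorem prefix_foldl_scanStep (v : List Bool) (s : ℕ × List ℕ) :
    s.2 <+: (v.foldl scanStep s).2 := by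
  induction v generalizing s with
  | nil => exact List.prefix_rfl
  | cons x v ih =>
    refine List.IsPrefix.trans ?_ (ih (scanStep s x))
    cases x <;> simp [scanStep]

theorem runs_mono {u v : List Bool} (h : u <+: v) : runs u <+: runs v := by
  obtain ⟨w, rfl⟩ := h
  simpa [runs, List.foldl_append] using prefix_foldl_scanStep w (u.foldl scanStep (0, []))

theorem primrec_runs : Primrec runs := by
  have hstep : Primrec₂ fun (_ : List Bool) (t : (ℕ × List ℕ) × Bool) => scanStep t.1 t.2 := by
    have ht : Primrec fun q : List Bool × ((ℕ × List ℕ) × Bool) => q.2.1 :=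
      Primrec.fst.comp Primrec.snd
    exact Primrec.cond (Primrec.snd.comp Primrec.snd)
      (Primrec.pair (Primrec.succ.comp (Primrec.fst.comp ht)) (Primrec.snd.comp ht))
      (Primrec.pair (Primrec.const 0)
        (Primrec.list_concat.comp (Primrec.snd.comp ht) (Primrec.fst.comp ht)))
  exact Primrec.snd.comp (Primrec.list_foldl Primrec.id (Primrec.const (0, [])) hstep)

/-- The word `0 1^(n+1)`. -/
def block (n : ℕ) : List Bool := false :: (List.range (n + 1)).map fun _ => true

theorem primrec_block : Primrec block :=
  Primrec.list_cons.comp (Primrec.const false)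
    (Primrec.list_map (Primrec.list_range.comp Primrec.succ) (Primrec.const true).to₂)

/-- The word `0 1^(ν₀+1) … 0 1^(ν_{K-1}+1)`. -/
def blocks (ν : ℕ → ℕ) : ℕ → List Bool
  | 0 => []
  | K + 1 => blocks ν K ++ block (ν K)

theorem blocks_mono (ν : ℕ → ℕ) {K L : ℕ} (h : K ≤ L) : blocks ν K <+: blocks ν L := by
  induction L, h using Nat.le_induction with
  | base => exact List.prefix_rfl
  | succ L _ ih => exact ih.trans (List.prefix_append _ _)

theorem blocks_congr {ν μ : ℕ → ℕ} {K : ℕ} (h : ∀ j < K, ν j = μ j) :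
    blocks ν K = blocks μ K := by
  induction K with
  | zero => rfl
  | succ K ih =>
    rw [blocks, blocks, ih fun j hj => h j (by omega), h K (by omega)]

theorem computable_blocks {α : Type*} [Primcodable α] {ν : α → ℕ → ℕ} {k : α → ℕ}
    (hν : Computable₂ ν) (hk : Computable k) : Computable fun a => blocks (ν a) (k a) := by
  have hstep : Computable₂ fun (a : α) (t : ℕ × List Bool) => t.2 ++ block (ν a t.1) :=
    Computable.list_append.comp (Computable.snd.comp Computable.snd)
      (primrec_block.to_comp.comp
        (hν.comp Computable.fst (Computable.fst.comp Computable.snd)))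
  refine (Computable.nat_rec hk (Computable.const []) hstep).of_eq fun a => ?_
  induction k a with
  | zero => rfl
  | succ K ih => exact congrArg (· ++ block (ν a K)) ih

theorem pre_add (p : Name) (m n : ℕ) :
    pre p (m + n) = pre p m ++ (List.range n).map fun k => p (m + k) := by
  simp [pre, List.range_add, Function.comp_def]

theorem pre_mono (p : Name) {m n : ℕ} (h : m ≤ n) : pre p m <+: pre p n := by
  obtain ⟨k, rfl⟩ := Nat.exists_eq_add_of_le h
  rw [pre_add]
  exact List.prefix_append _ _

theorem seqName_zeroPos (ν : ℕ → ℕ) (K : ℕ) : seqName ν (zeroPos ν K) = false := by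
  simp [seqName]

theorem seqName_zeroPos_add (ν : ℕ → ℕ) (K : ℕ) {k : ℕ} (hk : k < ν K + 1) :
    seqName ν (zeroPos ν K + (k + 1)) = true := by
  simp only [seqName, decide_eq_true_eq]
  rintro ⟨L, hL⟩
  have h1 : zeroPos ν K < zeroPos ν L := by omega
  have h2 : zeroPos ν L < zeroPos ν (K + 1) := by rw [zeroPos_succ]; omega
  rw [(zeroPos_strictMono ν).lt_iff_lt] at h1 h2
  omega

theorem pre_seqName (ν : ℕ → ℕ) (K : ℕ) : pre (seqName ν) (zeroPos ν K) = blocks ν K := by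
  induction K with
  | zero => rfl
  | succ K ih =>
    rw [zeroPos_succ, pre_add, ih, blocks, block, List.range_succ_eq_map, List.map_cons,
      List.map_map, Nat.add_zero, seqName_zeroPos]
    congr 2
    refine List.map_congr_left fun k hk => ?_
    exact seqName_zeroPos_add ν K (List.mem_range.1 hk)

theorem pre_seqName_succ (ν : ℕ → ℕ) (K : ℕ) :
    pre (seqName ν) (zeroPos ν K + 1) = blocks ν K ++ [false] := by
  rw [pre_add, pre_seqName]
  simp [seqName_zeroPos]

theorem foldl_scanStep_ones (n : ℕ) (s : ℕ × List ℕ) :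
    ((List.range n).map fun _ => true).foldl scanStep s = (s.1 + n, s.2) := by
  induction n with
  | zero => rfl
  | succ n ih => rw [List.range_succ, List.map_append, List.foldl_append, ih]; rfl

theorem foldl_scanStep_blocks (ν : ℕ → ℕ) (K : ℕ) :
    (blocks ν K ++ [false]).foldl scanStep (0, []) =
      (0, 0 :: (List.range K).map fun j => ν j + 1) := by
  induction K with
  | zero => rfl
  | succ K ih =>
    have h : blocks ν (K + 1) ++ [false] =
        (blocks ν K ++ [false]) ++ (((List.range (ν K + 1)).map fun _ => true) ++ [false]) := by
      simp [blocks, block]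
    rw [h, List.foldl_append, ih, List.foldl_append, foldl_scanStep_ones, List.range_succ]
    simp [scanStep]

/-- The first run is the empty word before the leading `0`; it carries no information. -/
theorem runs_pre_seqName (ν : ℕ → ℕ) (K : ℕ) :
    runs (pre (seqName ν) (zeroPos ν K + 1)) = 0 :: (List.range K).map fun j => ν j + 1 := by
  rw [runs, pre_seqName_succ, foldl_scanStep_blocks]

/-! ### Extracting computable functions from Type-2 machines -/

/-- The word of the letters at odd positions of a word. -/
def oddsWord (u : List Bool) : List Bool :=
  (List.range (u.length / 2)).map fun k => u.getD (2 * k + 1) false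

theorem computable_oddsWord : Computable oddsWord := by
  have h : Primrec oddsWord :=
    Primrec.list_map
      (Primrec.list_range.comp (Primrec.nat_div.comp Primrec.list_length (Primrec.const 2)))
      ((Primrec.list_getD false).comp Primrec.fst (Primrec.nat_double_succ.comp Primrec.snd))
  exact h.to_comp

theorem getD_eq_of_prefix {β : Type*} {u v : List β} (h : u <+: v) {k : ℕ}
    (hk : k < u.length) (d : β) : u.getD k d = v.getD k d := by
  obtain ⟨w, rfl⟩ := h
  simp [List.getD_eq_getElem?_getD, List.getElem?_append_left hk]

theorem oddsWord_mono {u v : List Bool} (h : u <+: v) : oddsWord u <+: oddsWord v := by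
  have hl := h.length_le
  obtain ⟨k, hk⟩ := Nat.exists_eq_add_of_le (Nat.div_le_div_right (c := 2) hl)
  refine ⟨(List.range k).map fun j => v.getD (2 * (u.length / 2 + j) + 1) false, ?_⟩
  rw [oddsWord, oddsWord, hk, List.range_add, List.map_append, List.map_map]
  congr 1
  refine List.map_congr_left fun j hj => ?_
  have := List.mem_range.1 hj
  exact getD_eq_of_prefix h (by omega) false

theorem oddsWord_pre (q : Name) (n : ℕ) : oddsWord (pre q (2 * n)) = pre (odds q) n := by
  have hl : (pre q (2 * n)).length = 2 * n := by simp [pre]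
  rw [oddsWord, hl, Nat.mul_div_cancel_left n (by norm_num)]
  refine List.map_congr_left fun k hk => ?_
  have := List.mem_range.1 hk
  have h : 2 * k + 1 < 2 * n := by omega
  simp [pre, odds, h]

theorem TypeTwoComputable.map_odds {F : Name →. Name} (hF : TypeTwoComputable F) :
    TypeTwoComputable fun p => (F p).map odds := by
  obtain ⟨φ, hφ, hmono, hex⟩ := hF
  refine ⟨fun u => oddsWord (φ u), computable_oddsWord.comp hφ,
    fun u v h => oddsWord_mono (hmono u v h), ?_⟩
  rintro p _ ⟨hp, rfl⟩ n
  obtain ⟨m, hm⟩ := hex p _ ⟨hp, rfl⟩ (2 * n)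
  exact ⟨m, oddsWord_pre _ n ▸ oddsWord_mono hm⟩

/-- Unbounded search: if `g a n` is defined for some `n`, for every `a`, then such values can be
computed from `a`. -/
theorem exists_computable_of_search {α σ : Type*} [Primcodable α] [Primcodable σ]
    {g : α → ℕ → Option σ} (hg : Computable₂ g) (hex : ∀ a, ∃ n x, g a n = some x) :
    ∃ f : α → σ, Computable f ∧ ∀ a, ∃ n, g a n = some (f a) := by
  have hdom : ∀ a, (Nat.rfindOpt (g a)).Dom := fun a => Nat.rfindOpt_dom.2 (hex a)
  refine ⟨fun a => (Nat.rfindOpt (g a)).get (hdom a),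
    Partrec.of_eq_tot (Partrec.rfindOpt hg) fun a => Part.get_mem _, fun a => ?_⟩
  exact Nat.rfindOpt_spec (Part.get_mem (hdom a))

/-- If a machine, started on uniformly primitive recursive inputs `P a`, produces the sequences
`0 1^(ν a 0 + 1) 0 1^(ν a 1 + 1) …`, then `ν` is computable: feed longer and longer prefixes of
`P a` to the machine until the wanted run of `1`s is complete. -/
theorem TypeTwoComputable.computable_of_seqName {α : Type*} [Primcodable α] {F : Name →. Name}
    (hF : TypeTwoComputable F) {P : α → Name} (hP : Primrec₂ P) {ν : α → ℕ → ℕ}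
    (h : ∀ a, seqName (ν a) ∈ F (P a)) : Computable₂ ν := by
  obtain ⟨φ, hφ, hmono, hex⟩ := hF
  have hpre : Computable fun t : (α × ℕ) × ℕ => pre (P t.1.1) t.2 :=
    (Primrec.list_map (g := fun (t : (α × ℕ) × ℕ) k => P t.1.1 k)
      (Primrec.list_range.comp Primrec.snd)
      (hP.comp (Primrec.fst.comp (Primrec.fst.comp Primrec.fst)) Primrec.snd)).to_comp
  have hget : ∀ a j, ∃ M, ∀ L, M ≤ L →
      (runs (φ (pre (P a) L)))[j + 1]? = some (ν a j + 1) := by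
    intro a j
    obtain ⟨M, hM⟩ := hex _ _ (h a) (zeroPos (ν a) (j + 1) + 1)
    refine ⟨M, fun L hL => ?_⟩
    obtain ⟨w, hw⟩ := runs_mono (hM.trans (hmono _ _ (pre_mono (P a) hL)))
    rw [← hw, runs_pre_seqName, List.getElem?_append_left (by simp)]
    simp
  let g : α × ℕ → ℕ → Option ℕ := fun t M =>
    ((runs (φ (pre (P t.1) M)))[t.2 + 1]?).map Nat.pred
  have hg : Computable₂ g := by
    refine Computable.option_map ?_ (Computable.pred.comp Computable.snd)
    exact Computable.list_getElem?.comp (primrec_runs.to_comp.comp (hφ.comp hpre))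
      (Computable.succ.comp (Computable.snd.comp Computable.fst))
  have hsound : ∀ t n x, g t n = some x → ν t.1 t.2 = x := by
    rintro ⟨a, j⟩ n x hx
    obtain ⟨M, hM⟩ := hget a j
    obtain ⟨y, hy, rfl⟩ := Option.map_eq_some_iff.1 hx
    have h1 := hM (max M n) (le_max_left _ _)
    obtain ⟨w, hw⟩ := runs_mono (hmono _ _ (pre_mono (P a) (le_max_right M n)))
    obtain ⟨hlt, -⟩ := List.getElem?_eq_some_iff.1 hy
    rw [← hw, List.getElem?_append_left hlt, hy] at h1
    exact (congrArg Nat.pred (Option.some.inj h1)).symm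
  obtain ⟨f, hf, hfg⟩ := exists_computable_of_search hg fun t => by
    obtain ⟨M, hM⟩ := hget t.1 t.2
    exact ⟨M, ν t.1 t.2, by simp [g, hM M le_rfl]⟩
  exact hf.of_eq fun t => by
    obtain ⟨n, hn⟩ := hfg t
    exact (hsound t n _ hn).symm

/-- The machine that transforms the sequence of the numbers `ν j` into the sequence of the numbers
`Q (ν (j + s)) j`. -/
theorem exists_typeTwoComputable_seqName {Q : ℕ → ℕ → ℕ} (hQ : Computable₂ Q) (s : ℕ) :
    ∃ F : Name →. Name, TypeTwoComputable F ∧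
      ∀ ν : ℕ → ℕ, seqName (fun j => Q (ν (j + s)) j) ∈ F (seqName ν) := by
  classical
  let κ : List Bool → ℕ → ℕ := fun u j => Q ((runs u).getD (j + s + 1) 0 - 1) j
  let φ : List Bool → List Bool := fun u => blocks (κ u) ((runs u).length - 1 - s)
  have hκ : Computable₂ κ := by
    have h : Primrec fun t : List Bool × ℕ => (runs t.1).getD (t.2 + s + 1) 0 - 1 :=
      Primrec.pred.comp ((Primrec.list_getD 0).comp (primrec_runs.comp Primrec.fst)
        (Primrec.succ.comp (Primrec.nat_add.comp Primrec.snd (Primrec.const s))))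
    exact hQ.comp h.to_comp Computable.snd
  have hφ : Computable φ := by
    refine computable_blocks hκ (Primrec.to_comp ?_)
    exact Primrec.nat_sub.comp (Primrec.pred.comp (Primrec.list_length.comp primrec_runs))
      (Primrec.const s)
  have hmono : ∀ u v, u <+: v → φ u <+: φ v := by
    intro u v h
    have hr := runs_mono h
    have hle := hr.length_le
    have hc : φ u = blocks (κ v) ((runs u).length - 1 - s) :=
      blocks_congr fun j hj => by
        simp only [κ, getD_eq_of_prefix hr (show j + s + 1 < (runs u).length by omega) 0]
    rw [hc]
    exact blocks_mono _ (by omega)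
  let F : Name →. Name := fun p =>
    ⟨∃ ν, p = seqName ν, fun h => seqName fun j => Q (h.choose (j + s)) j⟩
  have hF : ∀ ν q, q ∈ F (seqName ν) ↔ q = seqName fun j => Q (ν (j + s)) j := by
    intro ν q
    have hdom : (F (seqName ν)).Dom := ⟨ν, rfl⟩
    have hν : hdom.choose = ν := seqName_injective hdom.choose_spec.symm
    have hval : (F (seqName ν)).get hdom = seqName fun j => Q (ν (j + s)) j := by
      change (seqName fun j => Q (hdom.choose (j + s)) j) = _
      rw [hν]
    constructor
    · rintro ⟨_, rfl⟩
      exact hval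
    · rintro rfl
      exact ⟨hdom, hval⟩
  refine ⟨F, ⟨φ, hφ, hmono, ?_⟩, fun ν => (hF ν _).2 rfl⟩
  rintro p q hq n
  obtain ⟨ν, rfl⟩ : ∃ ν, p = seqName ν := hq.1
  obtain rfl := (hF ν q).1 hq
  set μ : ℕ → ℕ := fun j => Q (ν (j + s)) j with hμ
  refine ⟨zeroPos ν (n + s) + 1, ?_⟩
  have hr := runs_pre_seqName ν (n + s)
  have hout : φ (pre (seqName ν) (zeroPos ν (n + s) + 1)) = blocks μ n := by
    have hlen : (runs (pre (seqName ν) (zeroPos ν (n + s) + 1))).length - 1 - s = n := by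
      rw [hr]; simp
    simp only [φ, hlen]
    refine blocks_congr fun j hj => ?_
    have hlt : j + s < n + s := by omega
    simp only [κ, hr, μ]
    simp [hlt]
  rw [hout, ← pre_seqName]
  exact pre_mono _ (zeroPos_strictMono μ).le_apply

/-! ### Primitive recursive arithmetic of rational numbers and scalars -/

/-- The positive part `i` of the numerator of `realNum ⟨⟨i, j⟩, k⟩ = (i - j) / (k + 1)`. -/
def posPart (n : ℕ) : ℕ := n.unpair.1.unpair.1

/-- The negative part `j` of the numerator of `realNum ⟨⟨i, j⟩, k⟩ = (i - j) / (k + 1)`. -/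
def negPart (n : ℕ) : ℕ := n.unpair.1.unpair.2

/-- The denominator `k + 1` of `realNum ⟨⟨i, j⟩, k⟩ = (i - j) / (k + 1)`. -/
def denom (n : ℕ) : ℕ := n.unpair.2 + 1

/-- The code of the fraction `(i - j) / d`, for `0 < d`. -/
def fracCode (i j d : ℕ) : ℕ := Nat.pair (Nat.pair i j) (d - 1)

theorem realNum_eq (n : ℕ) : realNum n = ((posPart n : ℝ) - negPart n) / denom n := by
  simp [realNum, posPart, negPart, denom]

theorem denom_pos (n : ℕ) : 0 < denom n := Nat.succ_pos _

theorem realNum_fracCode (i j : ℕ) {d : ℕ} (hd : 0 < d) :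
    realNum (fracCode i j d) = ((i : ℝ) - j) / d := by
  obtain ⟨k, rfl⟩ := Nat.exists_eq_add_of_le' hd
  simp [realNum, fracCode]

theorem primrec_posPart : Primrec posPart :=
  Primrec.fst.comp (Primrec.unpair.comp (Primrec.fst.comp Primrec.unpair))

theorem primrec_negPart : Primrec negPart :=
  Primrec.snd.comp (Primrec.unpair.comp (Primrec.fst.comp Primrec.unpair))

theorem primrec_denom : Primrec denom :=
  Primrec.succ.comp (Primrec.snd.comp Primrec.unpair)

theorem primrec_fracCode {α : Type*} [Primcodable α] {i j d : α → ℕ} (hi : Primrec i)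
    (hj : Primrec j) (hd : Primrec d) : Primrec fun a => fracCode (i a) (j a) (d a) :=
  Primrec₂.natPair.comp (Primrec₂.natPair.comp hi hj) (Primrec.pred.comp hd)

/-- Addition on the codes of rational numbers. -/
def addCode (a b : ℕ) : ℕ :=
  fracCode (posPart a * denom b + posPart b * denom a) (negPart a * denom b + negPart b * denom a)
    (denom a * denom b)

/-- Multiplication on the codes of rational numbers. -/
def mulCode (a b : ℕ) : ℕ :=
  fracCode (posPart a * posPart b + negPart a * negPart b)
    (posPart a * negPart b + negPart a * posPart b) (denom a * denom b)

/-- Negation on the codes of rational numbers. -/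
def negCode (a : ℕ) : ℕ := fracCode (negPart a) (posPart a) (denom a)

/-- A code of the rational number `2⁻ⁿ`. -/
def halfPowCode (n : ℕ) : ℕ := fracCode 1 0 (2 ^ n)

theorem denom_ne_zero (n : ℕ) : (denom n : ℝ) ≠ 0 := by
  exact_mod_cast (denom_pos n).ne'

theorem realNum_addCode (a b : ℕ) : realNum (addCode a b) = realNum a + realNum b := by
  have ha := denom_ne_zero a
  have hb := denom_ne_zero b
  rw [addCode, realNum_fracCode _ _ (Nat.mul_pos (denom_pos a) (denom_pos b)), realNum_eq a,
    realNum_eq b]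
  push_cast
  field_simp
  ring

theorem realNum_mulCode (a b : ℕ) : realNum (mulCode a b) = realNum a * realNum b := by
  have ha := denom_ne_zero a
  have hb := denom_ne_zero b
  rw [mulCode, realNum_fracCode _ _ (Nat.mul_pos (denom_pos a) (denom_pos b)), realNum_eq a,
    realNum_eq b]
  push_cast
  field_simp
  ring

theorem realNum_negCode (a : ℕ) : realNum (negCode a) = -realNum a := by
  rw [negCode, realNum_fracCode _ _ (denom_pos a), realNum_eq a]
  ring

theorem realNum_halfPowCode (n : ℕ) : realNum (halfPowCode n) = (1 / 2 : ℝ) ^ n := by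
  rw [halfPowCode, realNum_fracCode _ _ (by positivity)]
  simp

theorem realNum_zero : realNum 0 = 0 := by simp [realNum]

theorem realNum_lt_iff (a b : ℕ) : realNum a < realNum b ↔
    posPart a * denom b + negPart b * denom a < posPart b * denom a + negPart a * denom b := by
  have ha : (0 : ℝ) < denom a := by exact_mod_cast denom_pos a
  have hb : (0 : ℝ) < denom b := by exact_mod_cast denom_pos b
  rw [realNum_eq, realNum_eq, div_lt_div_iff₀ ha hb]
  have hcast : (posPart a * denom b + negPart b * denom a <
      posPart b * denom a + negPart a * denom b) ↔
      ((posPart a : ℝ) * denom b + negPart b * denom a <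
        posPart b * denom a + negPart a * denom b) := by exact_mod_cast Iff.rfl
  rw [hcast]
  constructor <;> intro h <;> linarith

theorem abs_realNum_le (n : ℕ) : |realNum n| ≤ 2 * n := by
  have hp : posPart n ≤ n := (Nat.unpair_left_le _).trans (Nat.unpair_left_le _)
  have hn : negPart n ≤ n := (Nat.unpair_right_le _).trans (Nat.unpair_left_le _)
  have hp' : (posPart n : ℝ) ≤ n := by exact_mod_cast hp
  have hn' : (negPart n : ℝ) ≤ n := by exact_mod_cast hn
  have hd : (1 : ℝ) ≤ denom n := by exact_mod_cast denom_pos n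
  have h0 : |(posPart n : ℝ) - negPart n| ≤ 2 * n := by
    rw [abs_le]
    constructor <;> linarith [(posPart n).cast_nonneg (α := ℝ), (negPart n).cast_nonneg (α := ℝ)]
  rw [realNum_eq, abs_div, abs_of_pos (by linarith : (0 : ℝ) < denom n)]
  exact (div_le_self (abs_nonneg _) hd).trans h0

theorem primrec_addCode : Primrec₂ addCode := by
  have h1 : ∀ {f g : ℕ → ℕ}, Primrec f → Primrec g →
      Primrec fun t : ℕ × ℕ => f t.1 * g t.2 + f t.2 * g t.1 := fun hf hg =>
    Primrec.nat_add.comp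
      (Primrec.nat_mul.comp (hf.comp Primrec.fst) (hg.comp Primrec.snd))
      (Primrec.nat_mul.comp (hf.comp Primrec.snd) (hg.comp Primrec.fst))
  exact primrec_fracCode (h1 primrec_posPart primrec_denom) (h1 primrec_negPart primrec_denom)
    (Primrec.nat_mul.comp (primrec_denom.comp Primrec.fst) (primrec_denom.comp Primrec.snd))

theorem primrec_mulCode : Primrec₂ mulCode := by
  have h1 : ∀ {f g f' g' : ℕ → ℕ}, Primrec f → Primrec g → Primrec f' → Primrec g' →
      Primrec fun t : ℕ × ℕ => f t.1 * g t.2 + f' t.1 * g' t.2 := fun hf hg hf' hg' =>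
    Primrec.nat_add.comp
      (Primrec.nat_mul.comp (hf.comp Primrec.fst) (hg.comp Primrec.snd))
      (Primrec.nat_mul.comp (hf'.comp Primrec.fst) (hg'.comp Primrec.snd))
  exact primrec_fracCode
    (h1 primrec_posPart primrec_posPart primrec_negPart primrec_negPart)
    (h1 primrec_posPart primrec_negPart primrec_negPart primrec_posPart)
    (Primrec.nat_mul.comp (primrec_denom.comp Primrec.fst) (primrec_denom.comp Primrec.snd))

theorem primrec_negCode : Primrec negCode :=
  primrec_fracCode primrec_negPart primrec_posPart primrec_denom

theorem primrec_halfPowCode : Primrec halfPowCode := by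
  have hpow : Primrec fun n : ℕ => 2 ^ n :=
    (Primrec₂.unpaired'.1 Nat.Primrec.pow).comp (Primrec.const 2) Primrec.id
  exact primrec_fracCode (Primrec.const 1) (Primrec.const 0) hpow

theorem primrecRel_realNum_lt : PrimrecRel fun a b => realNum a < realNum b := by
  have h1 : ∀ {f : ℕ → ℕ}, Primrec f → ∀ {u v : ℕ × ℕ → ℕ}, Primrec u → Primrec v →
      Primrec fun t : ℕ × ℕ => f (u t) * denom (v t) := fun hf _ _ hu hv =>
    Primrec.nat_mul.comp (hf.comp hu) (primrec_denom.comp hv)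
  have h2 : PrimrecPred fun t : ℕ × ℕ =>
      posPart t.1 * denom t.2 + negPart t.2 * denom t.1 <
        posPart t.2 * denom t.1 + negPart t.1 * denom t.2 :=
    Primrec.nat_lt.comp
      (Primrec.nat_add.comp (h1 primrec_posPart Primrec.fst Primrec.snd)
        (h1 primrec_negPart Primrec.snd Primrec.fst))
      (Primrec.nat_add.comp (h1 primrec_posPart Primrec.snd Primrec.fst)
        (h1 primrec_negPart Primrec.fst Primrec.snd))
  exact h2.of_eq fun t => (realNum_lt_iff t.1 t.2).symm

section Scalar

variable (𝕜 : Type*) [RCLike 𝕜]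

theorem scalarNum_pair (a b : ℕ) :
    scalarNum 𝕜 (Nat.pair a b) = (realNum a : 𝕜) + (realNum b : 𝕜) * RCLike.I := by
  simp [scalarNum]

theorem scalarNum_zero : scalarNum 𝕜 0 = 0 := by
  have h := scalarNum_pair 𝕜 0 0
  simpa [realNum_zero, Nat.pair] using h

theorem norm_scalarNum_le (n : ℕ) : ‖scalarNum 𝕜 n‖ ≤ 4 * n := by
  have h1 := abs_realNum_le n.unpair.1
  have h2 := abs_realNum_le n.unpair.2
  have h3 : (n.unpair.1 : ℝ) ≤ n := by exact_mod_cast Nat.unpair_left_le n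
  have h4 : (n.unpair.2 : ℝ) ≤ n := by exact_mod_cast Nat.unpair_right_le n
  have h5 : ‖(realNum n.unpair.2 : 𝕜) * RCLike.I‖ ≤ |realNum n.unpair.2| := by
    rw [norm_mul, RCLike.norm_ofReal]
    refine mul_le_of_le_one_right (abs_nonneg _) ?_
    rcases eq_or_ne (RCLike.I : 𝕜) 0 with hI | hI
    · simp [hI]
    · exact (RCLike.norm_I_of_ne_zero hI).le
  have h6 := norm_add_le (realNum n.unpair.1 : 𝕜) ((realNum n.unpair.2 : 𝕜) * RCLike.I)
  rw [RCLike.norm_ofReal] at h6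
  rw [scalarNum]
  linarith

theorem exists_scalarAdd : ∃ add : ℕ → ℕ → ℕ, Primrec₂ add ∧
    ∀ a b, scalarNum 𝕜 (add a b) = scalarNum 𝕜 a + scalarNum 𝕜 b := by
  refine ⟨fun a b => Nat.pair (addCode a.unpair.1 b.unpair.1) (addCode a.unpair.2 b.unpair.2),
    ?_, fun a b => ?_⟩
  · have hl := Primrec.fst.comp Primrec.unpair
    have hr := Primrec.snd.comp Primrec.unpair
    exact Primrec₂.natPair.comp
      (primrec_addCode.comp (hl.comp Primrec.fst) (hl.comp Primrec.snd))
      (primrec_addCode.comp (hr.comp Primrec.fst) (hr.comp Primrec.snd))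
  · rw [scalarNum_pair, realNum_addCode, realNum_addCode, scalarNum, scalarNum]
    push_cast
    ring

/-- The numbering of the rational scalars admits a primitive recursive multiplication. For
`𝕜 = ℝ`, where `RCLike.I = 0`, only the first components of the codes matter. -/
theorem exists_scalarMul : ∃ mul : ℕ → ℕ → ℕ, Primrec₂ mul ∧
    ∀ a b, scalarNum 𝕜 (mul a b) = scalarNum 𝕜 a * scalarNum 𝕜 b := by
  have hl : Primrec fun n : ℕ => n.unpair.1 := Primrec.fst.comp Primrec.unpair
  have hr : Primrec fun n : ℕ => n.unpair.2 := Primrec.snd.comp Primrec.unpair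
  rcases RCLike.I_mul_I_ax (K := 𝕜) with hI | hI
  · refine ⟨fun a b => Nat.pair (mulCode a.unpair.1 b.unpair.1) 0, ?_, fun a b => ?_⟩
    · exact Primrec₂.natPair.comp
        (primrec_mulCode.comp (hl.comp Primrec.fst) (hl.comp Primrec.snd)) (Primrec.const 0)
    · rw [scalarNum_pair, realNum_mulCode, scalarNum, scalarNum, hI]
      push_cast
      ring
  · refine ⟨fun a b => Nat.pair
      (addCode (mulCode a.unpair.1 b.unpair.1) (negCode (mulCode a.unpair.2 b.unpair.2)))
      (addCode (mulCode a.unpair.1 b.unpair.2) (mulCode a.unpair.2 b.unpair.1)),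
      ?_, fun a b => ?_⟩
    · have hmul : ∀ f g : ℕ → ℕ, Primrec f → Primrec g →
          Primrec fun t : ℕ × ℕ => mulCode (f t.1) (g t.2) := fun _ _ hf hg =>
        primrec_mulCode.comp (hf.comp Primrec.fst) (hg.comp Primrec.snd)
      have hre := primrec_addCode.comp (hmul _ _ hl hl) (primrec_negCode.comp (hmul _ _ hr hr))
      have him := primrec_addCode.comp (hmul _ _ hl hr) (hmul _ _ hr hl)
      exact Primrec₂.natPair.comp hre him
    · rw [scalarNum_pair, realNum_addCode, realNum_addCode, realNum_negCode]
      simp only [realNum_mulCode, scalarNum]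
      push_cast
      linear_combination (-(realNum a.unpair.2 : 𝕜) * (realNum b.unpair.2 : 𝕜)) * hI

end Scalar

/-! ### Computable families of real numbers -/

/-- A family of real numbers is approximable if there are computable rational approximations with
computable rational error bounds that tend to zero. No rate is prescribed for the error
bounds, which keeps the closure under arithmetic operations free of precision bookkeeping. -/
def ApproximableReal {α : Type*} [Primcodable α] (f : α → ℝ) : Prop :=
  ∃ ν ε : α → ℕ → ℕ, Computable₂ ν ∧ Computable₂ ε ∧
    (∀ a j, |realNum (ν a j) - f a| ≤ realNum (ε a j)) ∧
    ∀ a, Filter.Tendsto (fun j => realNum (ε a j)) Filter.atTop (nhds 0)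

section ApproximableReal

variable {α β : Type*} [Primcodable α] [Primcodable β] {f g : α → ℝ}

theorem ApproximableReal.comp (hf : ApproximableReal f) {k : β → α} (hk : Computable k) :
    ApproximableReal fun b => f (k b) := by
  obtain ⟨ν, ε, hν, hε, h, ht⟩ := hf
  exact ⟨fun b => ν (k b), fun b => ε (k b), hν.comp (hk.comp Computable.fst) Computable.snd,
    hε.comp (hk.comp Computable.fst) Computable.snd, fun b => h (k b), fun b => ht (k b)⟩

theorem ApproximableReal.add (hf : ApproximableReal f) (hg : ApproximableReal g) :
    ApproximableReal fun a => f a + g a := by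
  obtain ⟨ν, ε, hν, hε, h, ht⟩ := hf
  obtain ⟨ν', ε', hν', hε', h', ht'⟩ := hg
  refine ⟨fun a j => addCode (ν a j) (ν' a j), fun a j => addCode (ε a j) (ε' a j),
    primrec_addCode.to_comp.comp hν hν', primrec_addCode.to_comp.comp hε hε',
    fun a j => ?_, fun a => ?_⟩
  · rw [realNum_addCode, realNum_addCode, add_sub_add_comm]
    exact (abs_add_le _ _).trans (add_le_add (h a j) (h' a j))
  · simp only [realNum_addCode]
    simpa using (ht a).add (ht' a)

theorem ApproximableReal.neg (hf : ApproximableReal f) : ApproximableReal fun a => -f a := by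
  obtain ⟨ν, ε, hν, hε, h, ht⟩ := hf
  refine ⟨fun a j => negCode (ν a j), ε, primrec_negCode.to_comp.comp hν, hε, fun a j => ?_, ht⟩
  rw [realNum_negCode, ← neg_add', abs_neg]
  simpa [sub_eq_add_neg] using h a j

theorem ApproximableReal.sq (hf : ApproximableReal f) : ApproximableReal fun a => f a ^ 2 := by
  obtain ⟨ν, ε, hν, hε, h, ht⟩ := hf
  -- `|y² - x²| ≤ ε (ε + 2 |y|) ≤ ε (ε + (y² + 1))` if `|y - x| ≤ ε`
  let c : ℕ := fracCode 1 0 1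
  have hc : realNum c = 1 := by rw [realNum_fracCode _ _ one_pos]; norm_num
  have hsq : Computable₂ fun a j => mulCode (ν a j) (ν a j) := primrec_mulCode.to_comp.comp hν hν
  refine ⟨fun a j => mulCode (ν a j) (ν a j),
    fun a j => mulCode (ε a j) (addCode (ε a j) (addCode (mulCode (ν a j) (ν a j)) c)), hsq,
    primrec_mulCode.to_comp.comp hε (primrec_addCode.to_comp.comp hε
      (primrec_addCode.to_comp.comp hsq (Computable.const c))), fun a j => ?_, fun a => ?_⟩
  · simp only [realNum_mulCode, realNum_addCode, hc]
    have h1 := abs_le.1 (h a j)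
    have h0 := (abs_nonneg _).trans (h a j)
    have h2 : |realNum (ν a j) + f a| ≤
        realNum (ε a j) + (realNum (ν a j) * realNum (ν a j) + 1) := by
      rw [abs_le]
      constructor <;>
        nlinarith [sq_nonneg (realNum (ν a j) - 1), sq_nonneg (realNum (ν a j) + 1)]
    have h3 : realNum (ν a j) * realNum (ν a j) - f a ^ 2 =
        (realNum (ν a j) - f a) * (realNum (ν a j) + f a) := by ring
    rw [h3, abs_mul]
    exact mul_le_mul (h a j) h2 (abs_nonneg _) h0
  · simp only [realNum_mulCode, realNum_addCode, hc]
    have hν0 : Filter.Tendsto (fun j => realNum (ν a j)) Filter.atTop (nhds (f a)) := by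
      rw [tendsto_iff_dist_tendsto_zero]
      exact squeeze_zero (fun _ => dist_nonneg) (fun j => h a j) (ht a)
    simpa using (ht a).mul ((ht a).add ((hν0.mul hν0).add_const 1))

/-- Search for a witness of a strict inequality: from a computable family of real numbers and
computable rational upper bounds one computes an index at which the bound holds, if there is
one for every parameter. -/
theorem ApproximableReal.exists_lt {f : α × ℕ → ℝ} (hf : ApproximableReal f) {r : α → ℕ}
    (hr : Computable r) (h : ∀ a, ∃ m, f (a, m) < realNum (r a)) :
    ∃ k : α → ℕ, Computable k ∧ ∀ a, f (a, k a) < realNum (r a) := by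
  classical
  obtain ⟨ν, ε, hν, hε, happ, ht⟩ := hf
  -- the test accepts `t = ⟨m, j⟩` if the `j`-th approximation confirms the bound at `m`
  let test : α → ℕ → Bool := fun a t => decide
    (realNum (addCode (ν (a, t.unpair.1) t.unpair.2) (ε (a, t.unpair.1) t.unpair.2)) <
      realNum (r a))
  have htest : Computable₂ test := by
    have ht1 : Computable fun q : α × ℕ => q.2.unpair := Computable.unpair.comp Computable.snd
    have ht2 : Computable fun q : α × ℕ => (q.1, q.2.unpair.1) :=
      Computable.pair Computable.fst (Computable.fst.comp ht1)
    have ht3 : Computable fun q : α × ℕ => q.2.unpair.2 := Computable.snd.comp ht1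
    have hlt : Computable₂ fun a b : ℕ => decide (realNum a < realNum b) :=
      primrecRel_realNum_lt.decide.to_comp
    exact hlt.comp
      (primrec_addCode.to_comp.comp (hν.comp ht2 ht3) (hε.comp ht2 ht3))
      (hr.comp Computable.fst)
  let g : α → ℕ → Option ℕ := fun a t => bif test a t then some t.unpair.1 else none
  have hg : Computable₂ g := Computable.cond htest
    (Computable.option_some.comp (Computable.fst.comp (Computable.unpair.comp Computable.snd)))
    (Computable.const none)
  obtain ⟨k, hk, hkg⟩ := exists_computable_of_search hg fun a => by
    obtain ⟨m, hm⟩ := h a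
    have hν0 : Filter.Tendsto (fun j => realNum (ν (a, m) j)) Filter.atTop (nhds (f (a, m))) := by
      rw [tendsto_iff_dist_tendsto_zero]
      exact squeeze_zero (fun _ => dist_nonneg) (fun j => happ (a, m) j) (ht (a, m))
    have hsum := hν0.add (ht (a, m))
    rw [add_zero] at hsum
    obtain ⟨j, hj⟩ := (hsum.eventually_lt_const hm).exists
    exact ⟨Nat.pair m j, m, by simp [g, test, realNum_addCode, hj]⟩
  refine ⟨k, hk, fun a => ?_⟩
  obtain ⟨t, hgt⟩ := hkg a
  cases hta : test a t with
  | false => simp [g, hta] at hgt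
  | true =>
    have hm : t.unpair.1 = k a := by simpa [g, hta] using hgt
    have hlt := of_decide_eq_true hta
    rw [realNum_addCode, hm] at hlt
    have := (abs_le.1 (happ (a, k a) t.unpair.2)).1
    linarith

end ApproximableReal

/-! ### Uniformly primitive recursive names -/

section Names

variable {α : Type*} [Primcodable α]

theorem primrec_natName {f : α → ℕ} (hf : Primrec f) : Primrec₂ fun a => natName (f a) := by
  have h : PrimrecPred fun t : α × ℕ => t.2 < f t.1 :=
    Primrec.nat_lt.comp Primrec.snd (hf.comp Primrec.fst)
  exact h.decide

theorem primrec_interleave {p q : α → Name} (hp : Primrec₂ p) (hq : Primrec₂ q) :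
    Primrec₂ fun a => interleave (p a) (q a) := by
  have hhalf : Primrec fun t : α × ℕ => t.2 / 2 :=
    Primrec.nat_div.comp Primrec.snd (Primrec.const 2)
  have hmod : PrimrecPred fun t : α × ℕ => t.2 % 2 = 0 :=
    Primrec.eq.comp (Primrec.nat_mod.comp Primrec.snd (Primrec.const 2)) (Primrec.const 0)
  exact Primrec.ite hmod (hp.comp Primrec.fst hhalf) (hq.comp Primrec.fst hhalf)

theorem seqName_const (m k : ℕ) : seqName (fun _ => m) k = !decide (k % (m + 2) = 0) := by
  have h : k ∈ Set.range (zeroPos fun _ => m) ↔ k % (m + 2) = 0 := by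
    rw [← Nat.dvd_iff_mod_eq_zero]
    constructor
    · rintro ⟨i, rfl⟩
      exact ⟨i, by simp [zeroPos, mul_comm]⟩
    · rintro ⟨i, rfl⟩
      exact ⟨i, by simp [zeroPos, mul_comm]⟩
  simp [seqName, h]

theorem primrec_seqName_const {f : α → ℕ} (hf : Primrec f) :
    Primrec₂ fun a => seqName fun _ => f a := by
  have h : PrimrecPred fun t : α × ℕ => t.2 % (f t.1 + 2) = 0 :=
    Primrec.eq.comp (Primrec.nat_mod.comp Primrec.snd
      (Primrec.nat_add.comp (hf.comp Primrec.fst) (Primrec.const 2))) (Primrec.const 0)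
  exact (Primrec.not.comp h.decide).of_eq fun t => (seqName_const (f t.1) t.2).symm

theorem natRep_names (n : ℕ) : natRep.names (natName n) n := rfl

theorem prodRep_names {X Y : Type*} {δ : Representation X} {δ' : Representation Y} {p q : Name}
    {x : X} {y : Y} (hp : δ.names p x) (hq : δ'.names q y) :
    (prodRep δ δ').names (interleave p q) (x, y) := by
  refine ⟨?_, ?_⟩
  · simpa [evens_interleave] using hp
  · simpa [odds_interleave] using hq

/-- A member of the dense sequence has a constant Cauchy name. -/
theorem cauchyRep_names_const {X : Type*} [MetricSpace X] {D : ℕ → X} (hD : DenseRange D)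
    (m : ℕ) : (cauchyRep D hD).names (seqName fun _ => m) (D m) :=
  ⟨fun _ => m, rfl, fun i j _ => by simp, tendsto_const_nhds⟩

end Names

/-! ### Computable approximations of computable points -/

theorem dist_le_of_cauchyName {X : Type*} [MetricSpace X] {D : ℕ → X} {n : ℕ → ℕ} {x : X}
    (hn : ∀ i j, i < j → dist (D (n i)) (D (n j)) < (1 / 2 : ℝ) ^ i)
    (hx : Filter.Tendsto (fun i => D (n i)) Filter.atTop (nhds x)) (i : ℕ) :
    dist (D (n i)) x ≤ (1 / 2 : ℝ) ^ i := by
  refine le_of_tendsto (tendsto_const_nhds.dist hx) ?_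
  filter_upwards [Filter.eventually_gt_atTop i] with j hj
  exact (hn i j hj).le

/-- The images of uniformly nameable points under a computable map into a metric space have
computable approximations. -/
theorem IsComputableMap.exists_approx {α X Y : Type*} [Primcodable α] [MetricSpace Y]
    {δ : Representation X} {D : ℕ → Y} {hD : DenseRange D} {f : X → Y}
    (hf : IsComputableMap δ (cauchyRep D hD) f) {x : α → X} {P : α → Name} (hP : Primrec₂ P)
    (hx : ∀ a, δ.names (P a) (x a)) :
    ∃ ν : α → ℕ → ℕ, Computable₂ ν ∧ ∀ a j, dist (D (ν a j)) (f (x a)) ≤ (1 / 2 : ℝ) ^ j := by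
  obtain ⟨F, hF, h⟩ := hf
  choose q hq n hqn hn hlim using fun a => h (P a) (x a) (hx a)
  exact ⟨n, hF.computable_of_seqName hP fun a => hqn a ▸ hq a,
    fun a => dist_le_of_cauchyName (hn a) (hlim a)⟩

section Hilbert

variable {𝕜 : Type*} [RCLike 𝕜] {H : Type*} [NormedAddCommGroup H] [InnerProductSpace 𝕜 H]
  {G : ℕ → Type*} [∀ i, NormedAddCommGroup (G i)] [∀ i, InnerProductSpace 𝕜 (G i)]
  {c : ∀ i, ℕ → G i} {α : Type*} [Primcodable α]

/-- The vectors `x a` of the spaces `G (k a)` have computable approximations by rational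
combinations. The index `k a` of the space is not required to be computable. -/
def ApproximableVector (𝕜 : Type*) [RCLike 𝕜] [∀ i, InnerProductSpace 𝕜 (G i)]
    (c : ∀ i, ℕ → G i) (k : α → ℕ) (x : ∀ a, G (k a)) : Prop :=
  ∃ ν : α → ℕ → ℕ, Computable₂ ν ∧
    ∀ a j, dist (ratComb 𝕜 (c (k a)) (ν a j)) (x a) ≤ (1 / 2 : ℝ) ^ j

theorem IsComputableMap.approximableVector {X : Type*} {δ : Representation X}
    {hc : IsComputableHilbertSequence 𝕜 c} {f : X → Σ i, G i}
    (hf : IsComputableMap δ (unionRep hc) f) {x : α → X} {P : α → Name} (hP : Primrec₂ P)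
    (hx : ∀ a, δ.names (P a) (x a)) :
    ApproximableVector 𝕜 c (fun a => (f (x a)).1) fun a => (f (x a)).2 := by
  obtain ⟨F, hF, h⟩ := hf
  choose q hq _ n hqn hn hlim using fun a => h (P a) (x a) (hx a)
  exact ⟨n, hF.map_odds.computable_of_seqName hP fun a => hqn a ▸ Part.mem_map odds (hq a),
    fun a => dist_le_of_cauchyName (hn a) (hlim a)⟩

theorem ApproximableVector.comp {β : Type*} [Primcodable β] {k : α → ℕ} {x : ∀ a, G (k a)}
    (hx : ApproximableVector 𝕜 c k x) {g : β → α} (hg : Computable g) :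
    ApproximableVector 𝕜 c (fun t => k (g t)) fun t => x (g t) := by
  obtain ⟨ν, hν, h⟩ := hx
  exact ⟨fun t => ν (g t), hν.comp (hg.comp Computable.fst) Computable.snd, fun t => h (g t)⟩

theorem ratComb_zero (b : ℕ → H) : ratComb 𝕜 b 0 = 0 := by
  have h : ∀ l : List ℕ, l = [] → ∑ k : Fin l.length, scalarNum 𝕜 (l.get k) • b k = 0 := by
    rintro _ rfl
    rfl
  exact h _ Denumerable.list_ofNat_zero

theorem approximableVector_zero (k : α → ℕ) :
    ApproximableVector 𝕜 c k fun _ => 0 :=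
  ⟨fun _ _ => 0, Computable.const 0, fun a j => by simp [ratComb_zero]⟩

theorem approximableReal_of_approx {f : α → ℝ} {ν : α → ℕ → ℕ} (hν : Computable₂ ν)
    (h : ∀ a j, dist (realNum (ν a j)) (f a) ≤ (1 / 2 : ℝ) ^ j) : ApproximableReal f := by
  refine ⟨ν, fun _ j => halfPowCode j, hν, primrec_halfPowCode.to_comp.comp Computable.snd,
    fun a j => ?_, fun a => ?_⟩
  · rw [realNum_halfPowCode]
    exact h a j
  · simp only [realNum_halfPowCode]
    exact tendsto_pow_atTop_nhds_zero_of_lt_one (by norm_num) (by norm_num)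

/-- In a sequence of computable Hilbert spaces, the distance of two computable vectors is
computable. -/
theorem ApproximableVector.dist (hc : IsComputableHilbertSequence 𝕜 c) {k : α → ℕ}
    (hk : Computable k) {x y : ∀ a, G (k a)} (hx : ApproximableVector 𝕜 c k x)
    (hy : ApproximableVector 𝕜 c k y) : ApproximableReal fun a => dist (x a) (y a) := by
  obtain ⟨D, hD, hDd⟩ := hc.dist_computable.exists_approx
    (x := fun t : ℕ × (ℕ × ℕ) => t)
    (P := fun t => interleave (natName t.1) (interleave (natName t.2.1) (natName t.2.2)))
    (primrec_interleave (primrec_natName Primrec.fst)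
      (primrec_interleave (primrec_natName (Primrec.fst.comp Primrec.snd))
        (primrec_natName (Primrec.snd.comp Primrec.snd))))
    fun t => prodRep_names (natRep_names _) (prodRep_names (natRep_names _) (natRep_names _))
  obtain ⟨ν, hν, hx⟩ := hx
  obtain ⟨μ, hμ, hy⟩ := hy
  have hhalf : Computable₂ fun (_ : α) j => halfPowCode j :=
    primrec_halfPowCode.to_comp.comp Computable.snd
  have hsum : ∀ j, realNum (addCode (halfPowCode j) (addCode (halfPowCode j) (halfPowCode j))) =
      3 * (1 / 2 : ℝ) ^ j := fun j => by
    rw [realNum_addCode, realNum_addCode, realNum_halfPowCode]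
    ring
  refine ⟨fun a j => D (k a, (ν a j, μ a j)) j,
    fun _ j => addCode (halfPowCode j) (addCode (halfPowCode j) (halfPowCode j)),
    hD.comp (Computable.pair (hk.comp Computable.fst) (Computable.pair hν hμ)) Computable.snd,
    primrec_addCode.to_comp.comp hhalf (primrec_addCode.to_comp.comp hhalf hhalf),
    fun a j => ?_, fun a => ?_⟩
  · rw [hsum, ← Real.dist_eq]
    have h1 := hDd (k a, (ν a j, μ a j)) j
    have h2 := dist_dist_dist_le (ratComb 𝕜 (c (k a)) (ν a j)) (ratComb 𝕜 (c (k a)) (μ a j))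
      (x a) (y a)
    have h3 := dist_triangle (realNum (D (k a, (ν a j, μ a j)) j))
      (Dist.dist (ratComb 𝕜 (c (k a)) (ν a j)) (ratComb 𝕜 (c (k a)) (μ a j)))
      (Dist.dist (x a) (y a))
    have h4 := hx a j
    have h5 := hy a j
    linarith
  · simp only [hsum]
    simpa using (tendsto_pow_atTop_nhds_zero_of_lt_one (r := (1 / 2 : ℝ)) (by norm_num)
      (by norm_num)).const_mul 3

theorem ApproximableVector.norm (hc : IsComputableHilbertSequence 𝕜 c) {k : α → ℕ}
    (hk : Computable k) {x : ∀ a, G (k a)} (hx : ApproximableVector 𝕜 c k x) :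
    ApproximableReal fun a => ‖x a‖ := by
  have h := hx.dist hc hk (approximableVector_zero k)
  simpa only [dist_zero_right] using h

/-! ### The vectors `Λᵢ* eᵢₖ` -/

theorem norm_sub_adjoint_sq [CompleteSpace H] {E : Type*} [NormedAddCommGroup E]
    [InnerProductSpace 𝕜 E] [CompleteSpace E] (L : H →L[𝕜] E) (x : H) (y : E) :
    ‖x - ContinuousLinearMap.adjoint L y‖ ^ 2 =
      ‖x‖ ^ 2 + dist (L x) y ^ 2 + -‖L x‖ ^ 2 + -‖y‖ ^ 2 +
        ‖ContinuousLinearMap.adjoint L y‖ ^ 2 := by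
  have h1 := norm_sub_sq (𝕜 := 𝕜) x (ContinuousLinearMap.adjoint L y)
  have h2 := norm_sub_sq (𝕜 := 𝕜) (L x) y
  rw [ContinuousLinearMap.adjoint_inner_right] at h1
  rw [dist_eq_norm]
  linarith

/-- The vectors `Λᵢ* eᵢₖ` are computable: since
`‖x - Λ* y‖² = ‖x‖² + ‖Λ x - y‖² - ‖Λ x‖² - ‖y‖² + ‖Λ* y‖²`
is a computable function of the rational combination `x`, one can search for an `x` at
which it is smaller than a given bound. -/
theorem exists_approx_adjoint [CompleteSpace H] [∀ i, CompleteSpace (G i)]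
    {b : ℕ → H} (hb : IsComputableHilbertSpace 𝕜 b) {hc : IsComputableHilbertSequence 𝕜 c}
    {e : ∀ i, ℕ → G i} (he : IsComputableMap (prodRep natRep natRep) (unionRep hc)
      fun t : ℕ × ℕ => (⟨t.1, e t.1 t.2⟩ : Σ i, G i))
    {Λ : ∀ i, H →L[𝕜] G i}
    (hΛ : IsComputableMap (prodRep natRep (hilbertRep hb.fundamental)) (unionRep hc)
      fun t : ℕ × H => (⟨t.1, Λ t.1 t.2⟩ : Σ i, G i))
    (hnorm : IsComputableMap (prodRep natRep natRep) realRep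
      fun t : ℕ × ℕ => ‖ContinuousLinearMap.adjoint (Λ t.1) (e t.1 t.2)‖) :
    ∃ M : ℕ × ℕ → ℕ → ℕ, Computable₂ M ∧ ∀ t n,
      dist (ratComb 𝕜 b (M t n)) (ContinuousLinearMap.adjoint (Λ t.1) (e t.1 t.2)) ≤
        (1 / 2 : ℝ) ^ n := by
  have hpair : Primrec₂ fun t : ℕ × ℕ => interleave (natName t.1) (natName t.2) :=
    primrec_interleave (primrec_natName Primrec.fst) (primrec_natName Primrec.snd)
  have hpairNames : ∀ t : ℕ × ℕ,
      (prodRep natRep natRep).names (interleave (natName t.1) (natName t.2)) t :=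
    fun t => prodRep_names (natRep_names _) (natRep_names _)
  have hE : ApproximableVector 𝕜 c (fun t : ℕ × ℕ => t.1) fun t => e t.1 t.2 :=
    he.approximableVector hpair hpairNames
  have hL : ApproximableVector 𝕜 c (fun t : ℕ × ℕ => t.1) fun t => Λ t.1 (ratComb 𝕜 b t.2) :=
    hΛ.approximableVector (x := fun t : ℕ × ℕ => (t.1, ratComb 𝕜 b t.2))
      (primrec_interleave (primrec_natName Primrec.fst) (primrec_seqName_const Primrec.snd))
      fun t => prodRep_names (natRep_names _) (cauchyRep_names_const _ _)
  have hN : ApproximableReal fun t : ℕ × ℕ =>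
      ‖ContinuousLinearMap.adjoint (Λ t.1) (e t.1 t.2)‖ := by
    obtain ⟨ν, hν, h⟩ := hnorm.exists_approx hpair hpairNames
    exact approximableReal_of_approx hν h
  have hA : ApproximableReal fun m : ℕ => ‖ratComb 𝕜 b m‖ := by
    obtain ⟨ν, hν, h⟩ := hb.dist_computable.exists_approx (x := fun m : ℕ => (m, 0))
      (primrec_interleave (primrec_natName Primrec.id) (primrec_natName (Primrec.const 0)))
      fun m => prodRep_names (natRep_names _) (natRep_names _)
    refine approximableReal_of_approx hν fun m j => ?_
    simpa [ratComb_zero] using h m j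
  have hf : ApproximableReal fun t : ((ℕ × ℕ) × ℕ) × ℕ =>
      ‖ratComb 𝕜 b t.2 - ContinuousLinearMap.adjoint (Λ t.1.1.1) (e t.1.1.1 t.1.1.2)‖ ^ 2 := by
    have hik : Computable fun t : ((ℕ × ℕ) × ℕ) × ℕ => t.1.1 :=
      Computable.fst.comp Computable.fst
    have hi : Computable fun t : ((ℕ × ℕ) × ℕ) × ℕ => t.1.1.1 := Computable.fst.comp hik
    have hL' := hL.comp (Computable.pair hi Computable.snd)
    have hE' := hE.comp hik
    simp only [norm_sub_adjoint_sq]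
    exact ((((hA.comp Computable.snd).sq.add (hL'.dist hc hi hE').sq).add
      (hL'.norm hc hi).sq.neg).add (hE'.norm hc hi).sq.neg).add (hN.comp hik).sq
  have hr : Computable fun s : (ℕ × ℕ) × ℕ => mulCode (halfPowCode s.2) (halfPowCode s.2) :=
    (primrec_mulCode.comp (primrec_halfPowCode.comp Primrec.snd)
      (primrec_halfPowCode.comp Primrec.snd)).to_comp
  have hrval : ∀ s : (ℕ × ℕ) × ℕ, realNum (mulCode (halfPowCode s.2) (halfPowCode s.2)) =
      ((1 / 2 : ℝ) ^ s.2) ^ 2 := fun s => by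
    rw [realNum_mulCode, realNum_halfPowCode, pow_two]
  obtain ⟨M, hM, hlt⟩ := hf.exists_lt hr fun s => by
    obtain ⟨m, hm⟩ := (ratComb_denseRange hb.fundamental).exists_dist_lt
      (ContinuousLinearMap.adjoint (Λ s.1.1) (e s.1.1 s.1.2))
      (show (0 : ℝ) < (1 / 2) ^ s.2 by positivity)
    refine ⟨m, ?_⟩
    rw [hrval, norm_sub_rev, ← dist_eq_norm]
    gcongr
  refine ⟨fun t n => M (t, n), hM, fun t n => ?_⟩
  have h := hlt (t, n)
  rw [hrval] at h
  rw [dist_eq_norm]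
  exact (lt_of_pow_lt_pow_left₀ 2 (by positivity) h).le

end Hilbert

/-! ### Rational combinations of computable vectors -/

section Combination

variable (𝕜 : Type*) [RCLike 𝕜] {H : Type*} [NormedAddCommGroup H] [InnerProductSpace 𝕜 H]

/-- The rational combination of `b` whose coefficients have the codes listed in `l`. -/
noncomputable def listComb (b : ℕ → H) (l : List ℕ) : H :=
  ∑ k ∈ Finset.range l.length, scalarNum 𝕜 (l.getD k 0) • b k

theorem ratComb_eq_listComb (b : ℕ → H) (n : ℕ) :
    ratComb 𝕜 b n = listComb 𝕜 b (Denumerable.ofNat (List ℕ) n) := by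
  rw [ratComb, listComb, Finset.sum_range]
  refine Finset.sum_congr rfl fun k _ => ?_
  simp

theorem listComb_eq_sum (b : ℕ → H) {l : List ℕ} {N : ℕ} (hN : l.length ≤ N) :
    listComb 𝕜 b l = ∑ k ∈ Finset.range N, scalarNum 𝕜 (l.getD k 0) • b k := by
  refine Finset.sum_subset (Finset.range_mono hN) fun k _ hk => ?_
  rw [List.getD_eq_default _ _ (by simpa using hk), scalarNum_zero, zero_smul]

theorem exists_listAdd : ∃ add : List ℕ → List ℕ → List ℕ, Primrec₂ add ∧
    ∀ (b : ℕ → H) l l', listComb 𝕜 b (add l l') = listComb 𝕜 b l + listComb 𝕜 b l' := by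
  obtain ⟨add, hadd, h⟩ := exists_scalarAdd 𝕜
  refine ⟨fun l l' => (List.range (l.length + l'.length)).map fun k =>
    add (l.getD k 0) (l'.getD k 0), ?_, fun b l l' => ?_⟩
  · refine Primrec.list_map (Primrec.list_range.comp (Primrec.nat_add.comp
      (Primrec.list_length.comp Primrec.fst) (Primrec.list_length.comp Primrec.snd)))
      (hadd.comp ?_ ?_)
    · exact (Primrec.list_getD 0).comp (Primrec.fst.comp Primrec.fst) Primrec.snd
    · exact (Primrec.list_getD 0).comp (Primrec.snd.comp Primrec.fst) Primrec.snd
  · rw [listComb_eq_sum 𝕜 b (Nat.le_add_right l.length l'.length),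
      listComb_eq_sum 𝕜 b (Nat.le_add_left l'.length l.length), ← Finset.sum_add_distrib, listComb,
      List.length_map, List.length_range]
    refine Finset.sum_congr rfl fun k hk => ?_
    rw [← add_smul, ← h, List.getD_eq_getElem _ _ (by simpa using hk)]
    simp

theorem exists_listSMul : ∃ smul : ℕ → List ℕ → List ℕ, Primrec₂ smul ∧
    ∀ (b : ℕ → H) a l, listComb 𝕜 b (smul a l) = scalarNum 𝕜 a • listComb 𝕜 b l := by
  obtain ⟨mul, hmul, h⟩ := exists_scalarMul 𝕜
  refine ⟨fun a l => l.map (mul a), ?_, fun b a l => ?_⟩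
  · exact Primrec.list_map Primrec.snd (hmul.comp (Primrec.fst.comp Primrec.fst) Primrec.snd)
  · rw [listComb, listComb, List.length_map, Finset.smul_sum]
    refine Finset.sum_congr rfl fun k hk => ?_
    have hk' : k < l.length := by simpa using hk
    rw [smul_smul, ← h, List.getD_eq_getElem _ _ (by simpa using hk'),
      List.getD_eq_getElem _ _ hk', List.getElem_map]

/-- The result of combining `t 0, …, t (K - 1)` by the operation `op`, starting with `[]`. -/
def accumulate (op : List ℕ → List ℕ → List ℕ) (t : ℕ → List ℕ) : ℕ → List ℕ
  | 0 => []
  | K + 1 => op (accumulate op t K) (t K)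

theorem computable_accumulate {α : Type*} [Primcodable α] {op : List ℕ → List ℕ → List ℕ}
    (hop : Computable₂ op) {t : α → ℕ → List ℕ} (ht : Computable₂ t) {k : α → ℕ}
    (hk : Computable k) : Computable fun a => accumulate op (t a) (k a) := by
  have hstep : Computable₂ fun (a : α) (q : ℕ × List ℕ) => op q.2 (t a q.1) :=
    hop.comp (Computable.snd.comp Computable.snd)
      (ht.comp Computable.fst (Computable.fst.comp Computable.snd))
  refine (Computable.nat_rec hk (Computable.const []) hstep).of_eq fun a => ?_
  induction k a with
  | zero => rfl
  | succ K ih => exact congrArg (op · (t a K)) ih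

/-- If the vectors `g k` have computable approximations, then so have their rational
combinations. -/
theorem exists_approx_ratComb {b g : ℕ → H} {M : ℕ → ℕ → ℕ} (hM : Computable₂ M)
    (h : ∀ k n, dist (ratComb 𝕜 b (M k n)) (g k) ≤ (1 / 2 : ℝ) ^ n) :
    ∃ Q : ℕ → ℕ → ℕ, Computable₂ Q ∧
      ∀ w n, dist (ratComb 𝕜 b (Q w n)) (ratComb 𝕜 g w) ≤ (1 / 2 : ℝ) ^ n := by
  obtain ⟨add, hadd, hadd_comb⟩ := exists_listAdd 𝕜 (H := H)
  obtain ⟨smul, hsmul, hsmul_comb⟩ := exists_listSMul 𝕜 (H := H)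
  -- the `k`-th coefficient has norm at most `4 a`, where `a` is its code; the precision
  -- `n + k + 1 + 4 a` makes the `k`-th error at most `2⁻⁽ⁿ⁺ᵏ⁺¹⁾`
  obtain ⟨term, hterm_def⟩ : ∃ term : List ℕ × ℕ → ℕ → List ℕ, ∀ p k, term p k =
      smul (p.1.getD k 0)
        (Denumerable.ofNat (List ℕ) (M k (p.2 + k + 1 + 4 * p.1.getD k 0))) :=
    ⟨_, fun _ _ => rfl⟩
  have hterm : Computable₂ term := by
    have hcoef : Primrec fun t : (List ℕ × ℕ) × ℕ => t.1.1.getD t.2 0 :=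
      (Primrec.list_getD 0).comp (Primrec.fst.comp Primrec.fst) Primrec.snd
    have hprec : Primrec fun t : (List ℕ × ℕ) × ℕ => t.1.2 + t.2 + 1 + 4 * t.1.1.getD t.2 0 :=
      Primrec.nat_add.comp (Primrec.succ.comp (Primrec.nat_add.comp
        (Primrec.snd.comp Primrec.fst) Primrec.snd))
        (Primrec.nat_mul.comp (Primrec.const 4) hcoef)
    have hlist := (Computable.ofNat (List ℕ)).comp (hM.comp Computable.snd hprec.to_comp)
    exact (hsmul.to_comp.comp hcoef.to_comp hlist).of_eq fun t => (hterm_def t.1 t.2).symm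
  have hterm_err : ∀ l n k, dist (listComb 𝕜 b (term (l, n) k)) (scalarNum 𝕜 (l.getD k 0) • g k) ≤
      (1 / 2 : ℝ) ^ (n + k + 1) := by
    intro l n k
    set a := l.getD k 0 with ha
    have h1 := h k (n + k + 1 + 4 * a)
    rw [ratComb_eq_listComb] at h1
    have h2 : (4 * a : ℝ) ≤ 2 ^ (4 * a) := by
      exact_mod_cast (Nat.lt_two_pow_self (n := 4 * a)).le
    have h3 : (2 : ℝ) ^ (4 * a) * (1 / 2) ^ (4 * a) = 1 := by
      rw [← mul_pow]; norm_num
    rw [hterm_def, ← ha, hsmul_comb, dist_smul₀]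
    calc _ ≤ (2 : ℝ) ^ (4 * a) * (1 / 2) ^ (n + k + 1 + 4 * a) :=
          mul_le_mul ((norm_scalarNum_le 𝕜 a).trans h2) h1 dist_nonneg (by positivity)
      _ = (1 / 2) ^ (n + k + 1) * ((2 : ℝ) ^ (4 * a) * (1 / 2) ^ (4 * a)) := by
          rw [pow_add _ (n + k + 1)]; ring
      _ = _ := by rw [h3, mul_one]
  have hS_err : ∀ l n K, dist (listComb 𝕜 b (accumulate add (term (l, n)) K))
      (∑ k ∈ Finset.range K, scalarNum 𝕜 (l.getD k 0) • g k) ≤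
        (1 / 2 : ℝ) ^ n * (1 - (1 / 2) ^ K) := by
    intro l n K
    induction K with
    | zero => simp [accumulate, listComb]
    | succ K ih =>
      rw [accumulate, hadd_comb, Finset.sum_range_succ]
      refine (dist_add_add_le _ _ _ _).trans ((add_le_add ih (hterm_err l n K)).trans_eq ?_)
      rw [pow_succ, pow_succ, pow_add]
      ring
  have hsum : Computable fun p : List ℕ × ℕ => accumulate add (term p) p.1.length :=
    computable_accumulate hadd.to_comp hterm (Computable.list_length.comp Computable.fst)
  have hdecode : Computable fun t : ℕ × ℕ => (Denumerable.ofNat (List ℕ) t.1, t.2) :=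
    ((Computable.ofNat (List ℕ)).comp Computable.fst).pair Computable.snd
  refine ⟨fun w n => Encodable.encode (accumulate add
    (term (Denumerable.ofNat (List ℕ) w, n)) (Denumerable.ofNat (List ℕ) w).length), ?_,
    fun w n => ?_⟩
  · exact Computable.encode.comp (hsum.comp hdecode)
  · rw [ratComb_eq_listComb, ratComb_eq_listComb, Denumerable.ofNat_encode]
    refine (hS_err _ n _).trans ?_
    refine mul_le_of_le_one_right (by positivity) ?_
    have : (0 : ℝ) ≤ (1 / 2) ^ (Denumerable.ofNat (List ℕ) w).length := by positivity
    linarith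

variable {𝕜}

/-- A bounded linear operator is computable if its values at the fundamental sequence have
computable approximations. The bound of the operator need not be known exactly: some power of
two above it enters as a finite shift. -/
theorem isComputableMap_of_approx {E : Type*} [NormedAddCommGroup E] [InnerProductSpace 𝕜 E]
    {a : ℕ → E} (ha : IsFundamental 𝕜 a) {b : ℕ → H} (hb : IsFundamental 𝕜 b) (T : E →L[𝕜] H)
    {M : ℕ → ℕ → ℕ} (hM : Computable₂ M)
    (h : ∀ k n, dist (ratComb 𝕜 b (M k n)) (T (a k)) ≤ (1 / 2 : ℝ) ^ n) :
    IsComputableMap (hilbertRep ha) (hilbertRep hb) T := by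
  obtain ⟨Q, hQ, hQ_err⟩ := exists_approx_ratComb 𝕜 hM h
  have hT : ∀ w, T (ratComb 𝕜 a w) = ratComb 𝕜 (fun k => T (a k)) w := fun w => by
    simp [ratComb, map_sum]
  obtain ⟨s, hs⟩ := pow_unbounded_of_one_lt ‖T‖ (one_lt_two (α := ℝ))
  have hQ' : Computable₂ fun w j => Q w (j + 2) :=
    hQ.comp Computable.fst ((Primrec.nat_add.comp Primrec.snd (Primrec.const 2)).to_comp)
  obtain ⟨F, hF, hFmem⟩ := exists_typeTwoComputable_seqName hQ' (s + 2)
  refine ⟨F, hF, ?_⟩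
  rintro p x ⟨ν, rfl, hν, hx⟩
  have herr : ∀ j, dist (ratComb 𝕜 b (Q (ν (j + (s + 2))) (j + 2))) (T x) ≤
      (1 / 2 : ℝ) ^ (j + 1) := by
    intro j
    have h1 := hQ_err (ν (j + (s + 2))) (j + 2)
    rw [← hT] at h1
    have h2 : dist (T (ratComb 𝕜 a (ν (j + (s + 2))))) (T x) ≤ (1 / 2 : ℝ) ^ (j + 2) := by
      have h3 : (2 : ℝ) ^ s * (1 / 2) ^ s = 1 := by rw [← mul_pow]; norm_num
      calc _ ≤ ‖T‖ * dist (ratComb 𝕜 a (ν (j + (s + 2)))) x := T.dist_le_opNorm _ _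
        _ ≤ 2 ^ s * (1 / 2) ^ (j + (s + 2)) :=
          mul_le_mul hs.le (dist_le_of_cauchyName hν hx _) dist_nonneg (by positivity)
        _ = (1 / 2) ^ (j + 2) * (2 ^ s * (1 / 2) ^ s) := by ring
        _ = _ := by rw [h3, mul_one]
    calc _ ≤ _ := dist_triangle _ _ _
      _ ≤ (1 / 2 : ℝ) ^ (j + 2) + (1 / 2) ^ (j + 2) := add_le_add h1 h2
      _ = _ := by ring
  refine ⟨_, hFmem ν, _, rfl, fun i j hij => ?_, ?_⟩
  · have h1 : (1 / 2 : ℝ) ^ (j + 1) < (1 / 2) ^ (i + 1) :=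
      pow_lt_pow_right_of_lt_one₀ (by norm_num) (by norm_num) (by omega)
    calc _ ≤ _ := dist_triangle_right _ _ (T x)
      _ ≤ (1 / 2 : ℝ) ^ (i + 1) + (1 / 2) ^ (j + 1) := add_le_add (herr i) (herr j)
      _ < (1 / 2 : ℝ) ^ (i + 1) + (1 / 2) ^ (i + 1) := by gcongr
      _ = _ := by ring
  · rw [tendsto_iff_dist_tendsto_zero]
    refine squeeze_zero (fun _ => dist_nonneg) herr ?_
    exact (tendsto_pow_atTop_nhds_zero_of_lt_one (by norm_num) (by norm_num)).comp
      (Filter.tendsto_add_atTop_nat 1)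

end Combination

/-! ### The synthesis operator -/

section Synthesis

variable {𝕜 : Type*} [RCLike 𝕜] {H : Type*} [NormedAddCommGroup H] [InnerProductSpace 𝕜 H]
  {G : ℕ → Type*} [∀ i, NormedAddCommGroup (G i)] [∀ i, InnerProductSpace 𝕜 (G i)]
  {Λ : ∀ i, H →L[𝕜] G i}

/-- The upper frame bound makes the analysis operator `f ↦ (Λᵢ f)ᵢ` bounded. -/
theorem IsGFrame.exists_analysis (hΛ : IsGFrame Λ) :
    ∃ Θ : H →L[𝕜] lp G 2, ∀ f i, Θ f i = Λ i f := by
  obtain ⟨A, B, hA, hAB, h⟩ := hΛ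
  have hmem : ∀ f, Memℓp (fun i => Λ i f) 2 := fun f => by
    rw [memℓp_gen_iff (by norm_num)]
    simpa using (h f).1
  let Θ : H →ₗ[𝕜] lp G 2 :=
    { toFun := fun f => ⟨fun i => Λ i f, hmem f⟩
      map_add' := fun f g => lp.ext (funext fun i => map_add (Λ i) f g)
      map_smul' := fun r f => lp.ext (funext fun i => map_smul (Λ i) r f) }
  refine ⟨Θ.mkContinuous √B fun f => ?_, fun f i => rfl⟩
  have hsq : ‖Θ f‖ ^ 2 = ∑' i, ‖Λ i f‖ ^ 2 := by
    have h2 := lp.norm_rpow_eq_tsum (p := 2) (by norm_num) (Θ f)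
    have hΘ : ∀ i, Θ f i = Λ i f := fun i => rfl
    simpa [hΘ] using h2
  have hB : 0 ≤ B := hA.le.trans hAB
  refine le_of_sq_le_sq ?_ (by positivity)
  rw [hsq, mul_pow, Real.sq_sqrt hB]
  exact (h f).2.2

/-- The synthesis operator is the adjoint of the analysis operator. -/
theorem IsGFrame.exists_synthesis [CompleteSpace H] [∀ i, CompleteSpace (G i)]
    (hΛ : IsGFrame Λ) :
    ∃ T : lp G 2 →L[𝕜] H,
      (∀ i x, T (lp.single 2 i x) = ContinuousLinearMap.adjoint (Λ i) x) ∧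
      ∀ f : lp G 2, HasSum (fun i => ContinuousLinearMap.adjoint (Λ i) (f i)) (T f) := by
  obtain ⟨Θ, hΘ⟩ := hΛ.exists_analysis
  have hsingle : ∀ i x, ContinuousLinearMap.adjoint Θ (lp.single 2 i x) =
      ContinuousLinearMap.adjoint (Λ i) x := fun i x => by
    refine ext_inner_left 𝕜 fun f => ?_
    rw [ContinuousLinearMap.adjoint_inner_right, ContinuousLinearMap.adjoint_inner_right,
      lp.inner_single_right, hΘ]
  refine ⟨ContinuousLinearMap.adjoint Θ, hsingle, fun f => ?_⟩
  have h := (ContinuousLinearMap.adjoint Θ).hasSum (lp.hasSum_single (p := 2) (by norm_num) f)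
  simpa only [hsingle] using h

end Synthesis

end CompAnalysis

theorem theorem3p11 {𝕜 : Type*} [RCLike 𝕜]
    {H : Type*} [NormedAddCommGroup H] [InnerProductSpace 𝕜 H] [CompleteSpace H]
    {G : ℕ → Type*} [∀ i, NormedAddCommGroup (G i)] [∀ i, InnerProductSpace 𝕜 (G i)]
    [∀ i, CompleteSpace (G i)]
    (b : ℕ → H) (hb : CompAnalysis.IsComputableHilbertSpace 𝕜 b)
    (c : ∀ i, ℕ → G i) (hc : CompAnalysis.IsComputableHilbertSequence 𝕜 c)
    (e : ∀ i, ℕ → G i) (he : CompAnalysis.IsComputableOrthonormalBases hc e)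
    (Λ : ∀ i, H →L[𝕜] G i) (hΛ : CompAnalysis.IsComputableGFrame hb hc Λ)
    (hnorm : CompAnalysis.IsComputableMap
      (CompAnalysis.prodRep CompAnalysis.natRep CompAnalysis.natRep) CompAnalysis.realRep
      fun t : ℕ × ℕ => ‖ContinuousLinearMap.adjoint (Λ t.1) (e t.1 t.2)‖) :
    ∃ T : lp G 2 →L[𝕜] H,
      (∀ f : lp G 2, HasSum (fun i => ContinuousLinearMap.adjoint (Λ i) (f i)) (T f)) ∧
      CompAnalysis.IsComputableMap (CompAnalysis.sumRep he)
        (CompAnalysis.hilbertRep hb.fundamental) T := by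
  obtain ⟨T, hsingle, hsum⟩ := hΛ.gframe.exists_synthesis
  refine ⟨T, hsum, ?_⟩
  obtain ⟨M, hM, hM_err⟩ :=
    CompAnalysis.exists_approx_adjoint hb he.computable hΛ.computable hnorm
  refine CompAnalysis.isComputableMap_of_approx _ hb.fundamental T
    (M := fun k n => M k.unpair n)
    (hM.comp (Computable.unpair.comp Computable.fst) Computable.snd) fun k n => ?_
  rw [CompAnalysis.sumSeq, hsingle]
  exact hM_err k.unpair n
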